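/- **Theorem 3.4.** Let $t>0$. For $\lambda\neq 0$ let $H(\lambda)=-\Delta+\lambda^2|x|^2$ be the scaled Hermite operator on $\mathbb R^d$ (here $d=n$ or $d=2n$), with orthonormal basis of eigenfunctions $\Phi_\alpha^\lambda(x)=|\lambda|^{d/4}\Phi_\alpha(|\lambda|^{1/2}x)$, $\alpha\in\mathbb N^d$, where $\Phi_\alpha$ are the normalized Hermite functions, and eigenvalues $(2|\alpha|+d)|\lambda|$. Let $$e^{-t\sqrt{H(\lambda)}}g=\sum_{\alpha\in\mathbb N^d}e^{-t\sqrt{(2|\alpha|+d)|\lambda|}}\,(g,\Phi_\alpha^\lambda)\,\Phi_\alpha^\lambda,\qquad \mathcal M_{t,\lambda}^\omega(\mathbb R^d)=e^{-t\sqrt{H(\lambda)}}\bigl(L^2(\mathbb R^d)\bigr),\qquad \mathcal M_t^\omega=\mathcal M_{t,1}^\omega(\mathbb R^n).$$ For $x,u\in\mathbb R^n$ and $\varphi\in L^2(\mathbb R^n)$ let $(\pi(x,u)\varphi)(\xi)=e^{i(x\cdot\xi+\frac12x\cdot u)}\varphi(\xi+u)$, and let the Weyl transform of a function $F$ on $\mathbb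 R^{2n}$ be $$W(F)\varphi=\int_{\mathbb R^{2n}}F(x,u)\,\pi(x,u)\varphi\,dx\,du .$$ For every $F\in\mathcal M_{\sqrt2t,1/2}^\omega(\mathbb R^{2n})$ and every $\varphi\in L^2(\mathbb R^n)$ this integral converges absolutely in $L^2(\mathbb R^n)$ (as a Bochner integral), and $$\bigl\{W(F)\varphi : F\in\mathcal M_{\sqrt2t,1/2}^\omega(\mathbb R^{2n}),\ \varphi\in L^2(\mathbb R^n)\bigr\}=\mathcal M_t^\omega .$$ -/

import Mathlib

open MeasureTheory
noncomputable section

/-- The complex Hilbert space `L²(ℝ^ι)` with respect to Lebesgue measure. -/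
abbrev L2 (ι : Type) [Fintype ι] : Type :=
  Lp ℂ 2 (volume : Measure (EuclideanSpace ℝ ι))

/-- The normalised Hermite function `h_k` on `ℝ`,
`h_k(x) = (√π 2^k k!)^{-1/2} H_k(x) e^{-x²/2}` with `H_k` the physicists' Hermite polynomial.
Since `Polynomial.hermite k` is the probabilists' polynomial `He_k` and
`H_k(x) = 2^{k/2} He_k(√2 x)`, this is `(√π k!)^{-1/2} He_k(√2 x) e^{-x²/2}`. -/
def hermiteFun (k : ℕ) (x : ℝ) : ℝ :=
  (Real.sqrt (Real.sqrt Real.pi * (k.factorial : ℝ)))⁻¹ *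
    Polynomial.aeval (Real.sqrt 2 * x) (Polynomial.hermite k) * Real.exp (-(x ^ 2 / 2))

/-- The scaled Hermite function on `ℝ^ι`, with `ι` of cardinality `d`:
`Φ_α^λ(x) = |λ|^{d/4} Φ_α(|λ|^{1/2} x)`, where `Φ_α(x) = ∏ i, h_{α i}(x i)`. -/
def scaledHermite {ι : Type} [Fintype ι] (lam : ℝ) (α : ι → ℕ) (x : EuclideanSpace ℝ ι) : ℝ :=
  |lam| ^ ((Fintype.card ι : ℝ) / 4) * ∏ i, hermiteFun (α i) (Real.sqrt |lam| * x i)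

/-- The eigenvalue `(2|α| + d)|λ|` of the scaled Hermite operator `H(λ)` on `ℝ^ι`, `d = card ι`,
belonging to the eigenfunction `Φ_α^λ`; see `hermiteOp_scaledHermite`. -/
def hermiteEigenvalue {ι : Type} [Fintype ι] (lam : ℝ) (α : ι → ℕ) : ℝ :=
  (2 * ∑ i, (α i : ℝ) + (Fintype.card ι : ℝ)) * |lam|

/-- The scaled Hermite operator `H(λ) f = -Δ f + λ² |x|² f` on `ℝ^ι`. -/
def hermiteOp {ι : Type} [Fintype ι] (lam : ℝ) (f : EuclideanSpace ℝ ι → ℝ)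
    (x : EuclideanSpace ℝ ι) : ℝ :=
  -(Laplacian.laplacian f x) + lam ^ 2 * ‖x‖ ^ 2 * f x

theorem derivative_hermite_succ (k : ℕ) :
    Polynomial.derivative (Polynomial.hermite (k + 1)) =
      ((k : Polynomial ℤ) + 1) * Polynomial.hermite k := by
  induction k with
  | zero => simp [Polynomial.hermite_succ]
  | succ k ih =>
    rw [Polynomial.hermite_succ (k + 1), Polynomial.derivative_sub, Polynomial.derivative_mul, ih,
      Polynomial.derivative_mul]
    rw [show Polynomial.derivative (Polynomial.hermite k) =
      Polynomial.X * Polynomial.hermite k - Polynomial.hermite (k + 1) by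
        rw [Polynomial.hermite_succ]; ring]
    simp
    ring

theorem hermite_ode (k : ℕ) :
    Polynomial.derivative (Polynomial.derivative (Polynomial.hermite k)) =
      Polynomial.X * Polynomial.derivative (Polynomial.hermite k) -
        (k : Polynomial ℤ) * Polynomial.hermite k := by
  have h := derivative_hermite_succ k
  rw [Polynomial.hermite_succ, Polynomial.derivative_sub, Polynomial.derivative_mul] at h
  simp at h
  linear_combination -h

theorem hasDerivAt_aeval_mul_exp (p : Polynomial ℤ) (c x : ℝ) :
    HasDerivAt (fun y : ℝ => c * Polynomial.aeval (Real.sqrt 2 * y) p * Real.exp (-(y ^ 2 / 2)))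
      (c * (Real.sqrt 2 * Polynomial.aeval (Real.sqrt 2 * x) (Polynomial.derivative p)
          - x * Polynomial.aeval (Real.sqrt 2 * x) p) * Real.exp (-(x ^ 2 / 2))) x := by
  have h1 : HasDerivAt (fun y : ℝ => Polynomial.aeval (Real.sqrt 2 * y) p)
      (Polynomial.aeval (Real.sqrt 2 * x) (Polynomial.derivative p) * (Real.sqrt 2 * 1)) x :=
    HasDerivAt.comp x (p.hasDerivAt_aeval (Real.sqrt 2 * x))
      ((hasDerivAt_id x).const_mul (Real.sqrt 2))
  have h2 : HasDerivAt (fun y : ℝ => Real.exp (-(y ^ 2 / 2)))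
      (Real.exp (-(x ^ 2 / 2)) * -(((2 : ℕ) * x ^ (2 - 1) * 1) / 2)) x :=
    ((((hasDerivAt_id x).pow 2).div_const 2).neg).exp
  refine ((h1.const_mul c).mul h2).congr_deriv ?_
  push_cast
  ring

theorem contDiff_hermiteFun (k : ℕ) {m : WithTop ℕ∞} : ContDiff ℝ m (hermiteFun k) := by
  unfold hermiteFun
  have : ContDiff ℝ m (fun x : ℝ => Polynomial.aeval (Real.sqrt 2 * x) (Polynomial.hermite k)) :=
    (Polynomial.contDiff_aeval _ _).comp (contDiff_const.mul contDiff_id)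
  fun_prop

/-- The one-dimensional eigenvalue equation `h_k'' = (x² - (2k+1)) h_k`. -/
theorem deriv_deriv_hermiteFun (k : ℕ) (x : ℝ) :
    deriv (deriv (hermiteFun k)) x = (x ^ 2 - (2 * k + 1)) * hermiteFun k x := by
  set c := (Real.sqrt (Real.sqrt Real.pi * (k.factorial : ℝ)))⁻¹ with hc
  have hd : deriv (hermiteFun k) = fun y =>
      (c * Real.sqrt 2) * Polynomial.aeval (Real.sqrt 2 * y)
        (Polynomial.derivative (Polynomial.hermite k)) * Real.exp (-(y ^ 2 / 2))
        - y * hermiteFun k y := by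
    funext y
    refine ((hasDerivAt_aeval_mul_exp (Polynomial.hermite k) c y).deriv).trans ?_
    simp only [hermiteFun, ← hc]
    ring
  have hk := (hasDerivAt_aeval_mul_exp (Polynomial.hermite k) c x)
  have hk' : HasDerivAt (hermiteFun k) _ x := hk
  rw [hd, ((hasDerivAt_aeval_mul_exp _ (c * Real.sqrt 2) x).fun_sub
    ((hasDerivAt_id' x).fun_mul hk')).deriv, hermite_ode]
  simp only [hermiteFun, ← hc, map_sub, map_mul, Polynomial.aeval_X, map_natCast]
  have h2 : Real.sqrt 2 * Real.sqrt 2 = 2 := Real.mul_self_sqrt (by norm_num)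
  linear_combination (c * Real.exp (-(x ^ 2 / 2)) * (Real.sqrt 2 * x *
    Polynomial.aeval (Real.sqrt 2 * x) (Polynomial.derivative (Polynomial.hermite k)) -
    k * Polynomial.aeval (Real.sqrt 2 * x) (Polynomial.hermite k))) * h2

theorem contDiff_scaledHermite {ι : Type} [Fintype ι] (lam : ℝ) (α : ι → ℕ)
    {m : WithTop ℕ∞} : ContDiff ℝ m (scaledHermite lam α) := by
  unfold scaledHermite
  refine contDiff_const.mul (contDiff_prod fun i _ => (contDiff_hermiteFun _).comp ?_)
  fun_prop

theorem secondDeriv_scaledHermite {ι : Type} [Fintype ι] [DecidableEq ι] (lam : ℝ) (α : ι → ℕ)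
    (x : EuclideanSpace ℝ ι) (i : ι) :
    iteratedFDeriv ℝ 2 (scaledHermite lam α) x
      ![EuclideanSpace.single i 1, EuclideanSpace.single i 1] =
    (lam ^ 2 * x i ^ 2 - (2 * α i + 1) * |lam|) * scaledHermite lam α x := by
  set v : EuclideanSpace ℝ ι := EuclideanSpace.single i 1 with hv
  set f := scaledHermite lam α with hf
  have hC : ContDiff ℝ 2 f := contDiff_scaledHermite lam α
  have hdf : Differentiable ℝ f := hC.differentiable (by norm_num)
  have hdf' : Differentiable ℝ (fderiv ℝ f) :=
    (hC.fderiv_right (m := 1) (by norm_num)).differentiable (by norm_num)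
  have hline : ∀ s : ℝ, HasDerivAt (fun s : ℝ => x + s • v) v s := fun s => by
    simpa using ((hasDerivAt_id' s).smul_const v).const_add x
  have h1 : deriv (fun s : ℝ => f (x + s • v)) = fun s => fderiv ℝ f (x + s • v) v := by
    funext s
    exact ((hdf _).hasFDerivAt.comp_hasDerivAt s (hline s)).deriv
  have h2 : deriv (fun s : ℝ => fderiv ℝ f (x + s • v) v) 0 = fderiv ℝ (fderiv ℝ f) x v v := by
    have := ((hdf' (x + (0 : ℝ) • v)).hasFDerivAt.comp_hasDerivAt (0 : ℝ) (hline 0))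
    have := (this.clm_apply (hasDerivAt_const (0 : ℝ) v)).deriv
    simpa using this
  rw [iteratedFDeriv_two_apply]
  simp only [Matrix.cons_val_zero, Matrix.cons_val_one]
  rw [← h2, ← h1]
  set a := Real.sqrt |lam| with ha
  have ha2 : a ^ 2 = |lam| := Real.sq_sqrt (abs_nonneg _)
  set K : ℝ := |lam| ^ ((Fintype.card ι : ℝ) / 4) *
    ∏ j ∈ Finset.univ.erase i, hermiteFun (α j) (a * x j) with hK
  have hfs : (fun s : ℝ => f (x + s • v)) = fun s => K * hermiteFun (α i) (a * s + a * x i) := by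
    funext s
    rw [hf, scaledHermite, ← Finset.mul_prod_erase Finset.univ _ (Finset.mem_univ i)]
    have : ∏ j ∈ Finset.univ.erase i, hermiteFun (α j) (Real.sqrt |lam| * (x + s • v) j) =
        ∏ j ∈ Finset.univ.erase i, hermiteFun (α j) (a * x j) := by
      refine Finset.prod_congr rfl fun j hj => ?_
      simp [hv, (Finset.ne_of_mem_erase hj), ha]
    rw [this, hK]
    have : Real.sqrt |lam| * (x + s • v) i = a * s + a * x i := by
      simp [hv, ha]; ring
    rw [this]; ring
  have hx : f x = K * hermiteFun (α i) (a * x i) := by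
    have := congrFun hfs 0
    simpa using this
  have hg : ∀ (g : ℝ → ℝ), Differentiable ℝ g → ∀ C : ℝ,
      deriv (fun s => C * g (a * s + a * x i)) = fun s => C * a * deriv g (a * s + a * x i) := by
    intro g hg C
    funext s
    have hl : HasDerivAt (fun s : ℝ => a * s + a * x i) a s := by
      simpa using ((hasDerivAt_id' s).const_mul a).add_const (a * x i)
    have := (((hg (a * s + a * x i)).hasDerivAt.comp s hl).const_mul C).deriv
    simp only [Function.comp_def] at this
    rw [this]; ring
  have hgd : Differentiable ℝ (hermiteFun (α i)) :=
    (contDiff_hermiteFun (m := 1) _).differentiable (by norm_num)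
  have hgd' : Differentiable ℝ (deriv (hermiteFun (α i))) :=
    (ContDiff.deriv' (n := 1) (contDiff_hermiteFun (α i))).differentiable (by norm_num)
  rw [hfs, hg _ hgd, hg _ hgd', hx]
  simp only [deriv_deriv_hermiteFun]
  have h4 : lam ^ 2 = a ^ 4 := by rw [show a ^ 4 = (a ^ 2) ^ 2 by ring, ha2, sq_abs]
  rw [h4, ← ha2]
  simp
  ring

/-- `H(λ) Φ_α^λ = (2|α| + d)|λ| Φ_α^λ`. -/
theorem hermiteOp_scaledHermite {ι : Type} [Fintype ι] (lam : ℝ) (α : ι → ℕ)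
    (x : EuclideanSpace ℝ ι) :
    hermiteOp lam (scaledHermite lam α) x = hermiteEigenvalue lam α * scaledHermite lam α x := by
  classical
  rw [hermiteOp, congrFun (InnerProductSpace.laplacian_eq_iteratedFDeriv_orthonormalBasis
    (scaledHermite lam α) (EuclideanSpace.basisFun ι ℝ)) x]
  simp only [EuclideanSpace.basisFun_apply, secondDeriv_scaledHermite]
  rw [← Finset.sum_mul, EuclideanSpace.norm_sq_eq, hermiteEigenvalue]
  simp only [Finset.sum_sub_distrib, ← Finset.mul_sum, ← Finset.sum_mul, Finset.sum_add_distrib,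
    Real.norm_eq_abs, sq_abs, Finset.sum_const, Finset.card_univ, nsmul_eq_mul]
  ring

theorem integrable_hermiteFun_sq (k : ℕ) : Integrable (fun x => hermiteFun k x ^ 2) := by
  have key : ∀ q : Polynomial ℝ, Integrable (fun x : ℝ => q.eval x * Real.exp (-1 * x ^ 2)) := by
    intro q
    induction q using Polynomial.induction_on' with
    | add p q hp hq =>
      simp only [Polynomial.eval_add, add_mul]
      exact hp.add hq
    | monomial m c =>
      have := (integrable_rpow_mul_exp_neg_mul_sq (b := 1) one_pos (s := (m : ℝ))
        (by have := Nat.cast_nonneg (α := ℝ) m; linarith)).const_mul c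
      simpa [Polynomial.eval_monomial, mul_assoc] using this
  refine (key (((Polynomial.C ((Real.sqrt (Real.sqrt Real.pi * (k.factorial : ℝ)))⁻¹) *
    ((Polynomial.hermite k).map (Int.castRingHom ℝ)).comp
      (Polynomial.C (Real.sqrt 2) * Polynomial.X)) ^ 2))).congr (Filter.Eventually.of_forall ?_)
  intro x
  have he : Real.exp (-1 * x ^ 2) = Real.exp (-(x ^ 2 / 2)) ^ 2 := by
    rw [← Real.exp_nat_mul]; congr 1; push_cast; ring
  simp only [hermiteFun, he, Polynomial.eval_pow, Polynomial.eval_mul, Polynomial.eval_C,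
    Polynomial.eval_comp, Polynomial.eval_X, Polynomial.eval_map, Polynomial.aeval_def,
    algebraMap_int_eq]
  ring

/-- Hermite functions are square integrable. -/
theorem memLp_scaledHermite {ι : Type} [Fintype ι] (lam : ℝ) (hlam : lam ≠ 0) (α : ι → ℕ) :
    MemLp (fun x : EuclideanSpace ℝ ι => (scaledHermite lam α x : ℂ)) 2 volume := by
  have hcont : Continuous (scaledHermite lam α) := (contDiff_scaledHermite (m := 0) lam α).continuous
  refine (memLp_two_iff_integrable_sq_norm
    (Complex.continuous_ofReal.comp hcont).aestronglyMeasurable).2 ?_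
  have ha : Real.sqrt |lam| ≠ 0 := by positivity
  have h1 : Integrable (fun y : ι → ℝ => ∏ i, hermiteFun (α i) (Real.sqrt |lam| * y i) ^ 2) :=
    Integrable.fintype_prod (f := fun i y => hermiteFun (α i) (Real.sqrt |lam| * y) ^ 2)
      fun i => (integrable_hermiteFun_sq (α i)).comp_mul_left' ha
  have h2 := ((EuclideanSpace.volume_preserving_symm_measurableEquiv_toLp ι).integrable_comp_emb
    (MeasurableEquiv.measurableEmbedding _)).2 h1
  refine (h2.const_mul ((|lam| ^ ((Fintype.card ι : ℝ) / 4)) ^ 2)).congr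
    (Filter.Eventually.of_forall fun x => ?_)
  have hn : ‖(scaledHermite lam α x : ℂ)‖ ^ 2 = scaledHermite lam α x ^ 2 := by
    rw [Complex.norm_real, Real.norm_eq_abs, sq_abs]
  refine Eq.trans ?_ hn.symm
  simp [scaledHermite, mul_pow, Finset.prod_pow]

/-- `Φ_α^λ` as an element of `L²(ℝ^ι)`. -/
def hermiteL2 {ι : Type} [Fintype ι] (lam : ℝ) (hlam : lam ≠ 0) (α : ι → ℕ) : L2 ι :=
  (memLp_scaledHermite lam hlam α).toLp _

/-! ### The Poisson-Hermite semigroup -/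

/-- `f = e^{-t √H(λ)} g` in `L²(ℝ^ι)`, by the spectral decomposition of `H(λ)` in its orthonormal
basis of eigenfunctions `Φ_α^λ`:
`f = ∑_α e^{-t √((2|α| + d)|λ|)} (g, Φ_α^λ) Φ_α^λ`, with convergence in `L²`. -/
def IsPoissonHermite {ι : Type} [Fintype ι] (t lam : ℝ) (hlam : lam ≠ 0) (g f : L2 ι) : Prop :=
  HasSum (fun α : ι → ℕ =>
    ((Real.exp (-(t * Real.sqrt (hermiteEigenvalue lam α))) : ℂ) *
      inner ℂ (hermiteL2 lam hlam α) g) • hermiteL2 lam hlam α) f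

/-- The space `e^{-t √H(λ)} (L²(ℝ^ι))`. -/
def poissonHermiteSpace (ι : Type) [Fintype ι] (t lam : ℝ) (hlam : lam ≠ 0) : Set (L2 ι) :=
  {f | ∃ g : L2 ι, IsPoissonHermite t lam hlam g f}

/-! ### The Schrödinger representation and the Weyl transform -/

theorem memLp_schrodinger {n : ℕ} (x u : EuclideanSpace ℝ (Fin n)) (φ : L2 (Fin n)) :
    MemLp (fun ξ : EuclideanSpace ℝ (Fin n) =>
      Complex.exp (Complex.I * ((inner ℝ x ξ + 1 / 2 * inner ℝ x u : ℝ) : ℂ)) * φ (ξ + u))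
      2 volume := by
  have h1 : MemLp (fun ξ => φ (ξ + u)) 2 volume :=
    (Lp.memLp φ).comp_measurePreserving (measurePreserving_add_right volume u)
  have hc : Continuous (fun ξ : EuclideanSpace ℝ (Fin n) =>
      Complex.exp (Complex.I * ((inner ℝ x ξ + 1 / 2 * inner ℝ x u : ℝ) : ℂ))) := by
    fun_prop
  refine MemLp.of_le h1 (hc.aestronglyMeasurable.mul h1.1) (Filter.Eventually.of_forall fun ξ => ?_)
  rw [norm_mul, mul_comm Complex.I, Complex.norm_exp_ofReal_mul_I, one_mul]

/-- The Schrödinger representation with parameter `1` at the point `(x, u, 0)` of the Heisenberg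
group, acting on `L²(ℝⁿ)`: `(π(x,u) φ)(ξ) = e^{i (x·ξ + ½ x·u)} φ(ξ + u)`. -/
def schrodinger {n : ℕ} (x u : EuclideanSpace ℝ (Fin n)) (φ : L2 (Fin n)) : L2 (Fin n) :=
  (memLp_schrodinger x u φ).toLp _

/-- The component `x` of a point `(x, u)` of `ℝ²ⁿ = ℝⁿ × ℝⁿ`. -/
def fstHalf {n : ℕ} (p : EuclideanSpace ℝ (Fin n ⊕ Fin n)) : EuclideanSpace ℝ (Fin n) :=
  WithLp.toLp 2 fun i => p (Sum.inl i)

/-- The component `u` of a point `(x, u)` of `ℝ²ⁿ = ℝⁿ × ℝⁿ`. -/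
def sndHalf {n : ℕ} (p : EuclideanSpace ℝ (Fin n ⊕ Fin n)) : EuclideanSpace ℝ (Fin n) :=
  WithLp.toLp 2 fun i => p (Sum.inr i)

/-- The integrand `(x, u) ↦ F(x, u) π(x, u) φ` of the Weyl transform, with values in `L²(ℝⁿ)`. -/
def weylIntegrand {n : ℕ} (F : L2 (Fin n ⊕ Fin n)) (φ : L2 (Fin n))
    (p : EuclideanSpace ℝ (Fin n ⊕ Fin n)) : L2 (Fin n) :=
  F p • schrodinger (fstHalf p) (sndHalf p) φ

/-- The Weyl transform `W(F) φ = ∫_{ℝ²ⁿ} F(x, u) π(x, u) φ dx du`, a Bochner integral in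
`L²(ℝⁿ)`. -/
def weylTransform {n : ℕ} (F : L2 (Fin n ⊕ Fin n)) (φ : L2 (Fin n)) : L2 (Fin n) :=
  ∫ p, weylIntegrand F φ p

end

/-!
The special Hermite functions `S_{jk}(x, u) = (2π)^{-n/2} (π(x, u) Φ_k, Φ_j)` are orthonormal in
`L²(ℝ²ⁿ)`, and `S_{jk}` is an eigenfunction of `H(1/2)` with eigenvalue `|j| + |k| + n`: one plane
`(x i, u i)` at a time, rotating the coordinates by `45°` under the integral defining `S_{jk}`
preserves the total Hermite degree, and the remaining integral is the Fourier transform of a Hermite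
function. The matrix coefficients of the Weyl transform are therefore
`(W(F) Φ_k, Φ_j) = (2π)^{n/2} ∫ F S_{jk}`, and `F = e^{-√2 t √H(1/2)} g` damps the `(j, k)`
coefficient of `g` by `e^{-t √((2|j| + n) + (2|k| + n))}`. This is at most `e^{-t √(2|j| + n)}`, so
Cauchy–Schwarz in `k` gives `W(F) φ ∈ e^{-t √H} L²`. Conversely, for `k = 0` the two weights differ
by a factor of at most `e^{t √n}`, so every `ψ ∈ e^{-t √H} L²` is `W(F) Φ_0` for an `F` whose only
nonzero coefficients are those of the `S_{j0}`. Convergence of `W(F) φ` holds because the Hermite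
series of `F` converges in `L¹`, hence `F` is integrable, and the `π(x, u)` are isometries.
-/

noncomputable section

open Finset
open Complex (I)
open Polynomial (aeval hermite)
open scoped ComplexConjugate InnerProductSpace

/-! ### Hermite functions on the line -/

theorem aeval_derivative_hermite (k : ℕ) (y : ℝ) :
    aeval y (Polynomial.derivative (hermite k)) = k * aeval y (hermite (k - 1)) := by
  cases k with
  | zero => simp
  | succ k => rw [derivative_hermite_succ, map_mul]; simp

theorem aeval_hermite_succ (k : ℕ) (y : ℝ) :
    aeval y (hermite (k + 1)) = y * aeval y (hermite k) - k * aeval y (hermite (k - 1)) := by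
  rw [Polynomial.hermite_succ, map_sub, map_mul, Polynomial.aeval_X, aeval_derivative_hermite]

/-- The constant `(√π k!)^{-1/2}` that normalises the Hermite function `h_k` in `L²(ℝ)`. -/
def hermiteConst (k : ℕ) : ℝ := (√(√Real.pi * (k.factorial : ℝ)))⁻¹

theorem hermiteFun_eq (k : ℕ) (x : ℝ) :
    hermiteFun k x = hermiteConst k * aeval (√2 * x) (hermite k) * Real.exp (-(x ^ 2 / 2)) := rfl

theorem hermiteFun_zero (x : ℝ) : hermiteFun 0 x = hermiteConst 0 * Real.exp (-(x ^ 2 / 2)) := by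
  simp [hermiteFun_eq]

theorem hermiteConst_zero_sq : hermiteConst 0 ^ 2 = (√Real.pi)⁻¹ := by
  simp [hermiteConst, Real.sq_sqrt]

theorem sqrt_mul_hermiteConst_succ (k : ℕ) :
    √(k + 1) * hermiteConst (k + 1) = hermiteConst k := by
  have hk : √((k : ℝ) + 1) ≠ 0 := by positivity
  have hfact : √Real.pi * ((k + 1).factorial : ℝ) = (k + 1) * (√Real.pi * k.factorial) := by
    rw [Nat.factorial_succ]
    push_cast
    ring
  rw [hermiteConst, hfact, Real.sqrt_mul (by positivity), mul_inv, mul_inv_cancel_left₀ hk,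
    hermiteConst]

theorem sqrt_mul_hermiteConst_pred (k : ℕ) : √k * hermiteConst (k - 1) = hermiteConst k * k := by
  cases k with
  | zero => simp
  | succ k =>
    rw [Nat.add_sub_cancel, ← sqrt_mul_hermiteConst_succ, ← mul_assoc, Nat.cast_succ,
      Real.mul_self_sqrt (by positivity), mul_comm]

theorem sqrt_two_mul_hermiteFun (k : ℕ) (x : ℝ) :
    √2 * x * hermiteFun k x = √(k + 1) * hermiteFun (k + 1) x + √k * hermiteFun (k - 1) x := by
  simp only [hermiteFun_eq, ← mul_assoc, sqrt_mul_hermiteConst_succ, sqrt_mul_hermiteConst_pred,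
    aeval_hermite_succ]
  ring

theorem hasDerivAt_hermiteFun_annihilation (k : ℕ) (x : ℝ) :
    HasDerivAt (hermiteFun k) (√2 * √k * hermiteFun (k - 1) x - x * hermiteFun k x) x := by
  refine (hasDerivAt_aeval_mul_exp (hermite k) (hermiteConst k) x).congr_deriv ?_
  rw [mul_assoc (√2), hermiteFun_eq (k - 1), ← mul_assoc (√k), ← mul_assoc (√k),
    sqrt_mul_hermiteConst_pred, hermiteFun_eq k, aeval_derivative_hermite]
  ring

theorem hasDerivAt_hermiteFun_creation (k : ℕ) (x : ℝ) :
    HasDerivAt (hermiteFun k) (x * hermiteFun k x - √2 * √(k + 1) * hermiteFun (k + 1) x) x := by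
  refine (hasDerivAt_hermiteFun_annihilation k x).congr_deriv ?_
  have hs : √2 * √2 = (2 : ℝ) := Real.mul_self_sqrt zero_le_two
  linear_combination x * hermiteFun k x * hs - √2 * sqrt_two_mul_hermiteFun k x

theorem hasDerivAt_sqrt_two_mul_hermiteFun (k : ℕ) (x : ℝ) :
    HasDerivAt (fun x => √2 * hermiteFun k x)
      (√k * hermiteFun (k - 1) x - √(k + 1) * hermiteFun (k + 1) x) x := by
  refine ((hasDerivAt_hermiteFun_annihilation k x).const_mul (√2)).congr_deriv ?_
  have hs : √2 * √2 = (2 : ℝ) := Real.mul_self_sqrt zero_le_two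
  linear_combination √k * hermiteFun (k - 1) x * hs - sqrt_two_mul_hermiteFun k x

@[fun_prop]
theorem continuous_hermiteFun (k : ℕ) : Continuous (hermiteFun k) :=
  (contDiff_hermiteFun (m := 0) k).continuous

theorem memLp_hermiteFun (k : ℕ) : MemLp (hermiteFun k) 2 :=
  (memLp_two_iff_integrable_sq (continuous_hermiteFun k).aestronglyMeasurable).2
    (integrable_hermiteFun_sq k)

theorem integrable_hermiteFun_mul (j k : ℕ) :
    Integrable (fun x => hermiteFun j x * hermiteFun k x) :=
  (memLp_hermiteFun j).integrable_mul (memLp_hermiteFun k)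

theorem sqrt_mul_integral_hermiteFun_succ_mul (j k : ℕ) :
    √(j + 1) * ∫ x, hermiteFun (j + 1) x * hermiteFun k x =
      √k * ∫ x, hermiteFun j x * hermiteFun (k - 1) x := by
  have hderiv (x : ℝ) : HasDerivAt (fun x => hermiteFun j x * hermiteFun k x)
      (√2 * (√k * (hermiteFun j x * hermiteFun (k - 1) x) -
        √(j + 1) * (hermiteFun (j + 1) x * hermiteFun k x))) x := by
    refine ((hasDerivAt_hermiteFun_creation j x).mul
      (hasDerivAt_hermiteFun_annihilation k x)).congr_deriv ?_
    ring
  have hlow := (integrable_hermiteFun_mul j (k - 1)).const_mul (√k)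
  have hhigh := (integrable_hermiteFun_mul (j + 1) k).const_mul (√(j + 1))
  have hzero := integral_eq_zero_of_hasDerivAt_of_integrable hderiv ((hlow.sub hhigh).const_mul _)
    (integrable_hermiteFun_mul j k)
  rw [integral_const_mul, integral_sub hlow hhigh, integral_const_mul, integral_const_mul,
    mul_eq_zero, sub_eq_zero] at hzero
  exact (hzero.resolve_left (by positivity)).symm

theorem integral_hermiteFun_zero_sq : ∫ x, hermiteFun 0 x * hermiteFun 0 x = 1 := by
  have hsq (x : ℝ) :
      hermiteFun 0 x * hermiteFun 0 x = hermiteConst 0 ^ 2 * Real.exp (-1 * x ^ 2) := by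
    rw [hermiteFun_zero, show -1 * x ^ 2 = -(x ^ 2 / 2) + -(x ^ 2 / 2) by ring, Real.exp_add]
    ring
  simp only [hsq]
  rw [integral_const_mul, integral_gaussian, hermiteConst_zero_sq, div_one]
  exact inv_mul_cancel₀ (by positivity)

theorem integral_hermiteFun_mul (j k : ℕ) :
    ∫ x, hermiteFun j x * hermiteFun k x = if j = k then 1 else 0 := by
  have succ_zero (j : ℕ) : ∫ x, hermiteFun (j + 1) x * hermiteFun 0 x = 0 := by
    have h := sqrt_mul_integral_hermiteFun_succ_mul j 0
    rw [Nat.cast_zero, Real.sqrt_zero, zero_mul, mul_eq_zero] at h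
    exact h.resolve_left (by positivity)
  induction j generalizing k with
  | zero =>
    cases k with
    | zero => simpa using integral_hermiteFun_zero_sq
    | succ k => simpa [mul_comm] using succ_zero k
  | succ j ih =>
    cases k with
    | zero => simpa using succ_zero j
    | succ k =>
      have h := sqrt_mul_integral_hermiteFun_succ_mul j (k + 1)
      simp only [Nat.add_sub_cancel, ih] at h
      refine mul_left_cancel₀ (by positivity : √((j : ℝ) + 1) ≠ 0) (h.trans ?_)
      split_ifs with hjk <;> simp_all

/-! ### Integrability and Fourier transforms of Hermite functions -/

section WeightedSquare

variable {f : ℝ → ℝ}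

theorem two_mul_abs_le_inv_one_add_sq_add (x a : ℝ) :
    2 * |a| ≤ (1 + x ^ 2)⁻¹ + (1 + x ^ 2) * a ^ 2 := by
  have hx : 0 < 1 + x ^ 2 := by positivity
  have h := two_mul_le_add_sq (√(1 + x ^ 2)⁻¹) (√(1 + x ^ 2) * |a|)
  rwa [mul_assoc, ← mul_assoc (√_), ← Real.sqrt_mul (by positivity), inv_mul_cancel₀ hx.ne',
    Real.sqrt_one, one_mul, mul_pow, Real.sq_sqrt (by positivity), Real.sq_sqrt hx.le,
    sq_abs] at h

theorem integrable_of_integrable_one_add_sq_mul_sq (hf : AEStronglyMeasurable f)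
    (hint : Integrable fun x => (1 + x ^ 2) * f x ^ 2) : Integrable f := by
  refine (integrable_inv_one_add_sq.add hint).mono' hf (.of_forall fun x => ?_)
  rw [Real.norm_eq_abs, Pi.add_apply]
  linarith [two_mul_abs_le_inv_one_add_sq_add x (f x), abs_nonneg (f x)]

theorem two_mul_integral_abs_le (hint : Integrable fun x => (1 + x ^ 2) * f x ^ 2) :
    2 * ∫ x, |f x| ≤ Real.pi + ∫ x, (1 + x ^ 2) * f x ^ 2 := by
  rw [← integral_const_mul, ← integral_univ_inv_one_add_sq,
    ← integral_add integrable_inv_one_add_sq hint]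
  exact integral_mono_of_nonneg (.of_forall fun x => by positivity)
    (integrable_inv_one_add_sq.add hint)
    (.of_forall fun x => two_mul_abs_le_inv_one_add_sq_add x (f x))

end WeightedSquare

theorem sq_mul_hermiteFun_sq (k : ℕ) (x : ℝ) :
    (1 + x ^ 2) * hermiteFun k x ^ 2 = hermiteFun k x * hermiteFun k x +
      ((k + 1) / 2 * (hermiteFun (k + 1) x * hermiteFun (k + 1) x) +
        (√(k + 1) * √k * (hermiteFun (k + 1) x * hermiteFun (k - 1) x) +
          k / 2 * (hermiteFun (k - 1) x * hermiteFun (k - 1) x))) := by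
  have hrec := congrArg (· ^ 2) (sqrt_two_mul_hermiteFun k x)
  simp only [mul_pow, add_sq, Real.sq_sqrt zero_le_two, Real.sq_sqrt (Nat.cast_nonneg (α := ℝ) k),
    Real.sq_sqrt (by positivity : (0 : ℝ) ≤ k + 1)] at hrec
  linear_combination hrec / 2

theorem integrable_one_add_sq_mul_hermiteFun_sq (k : ℕ) :
    Integrable fun x => (1 + x ^ 2) * hermiteFun k x ^ 2 := by
  simp only [sq_mul_hermiteFun_sq]
  have h := integrable_hermiteFun_mul
  exact (h _ _).add (((h _ _).const_mul _).add (((h _ _).const_mul _).add ((h _ _).const_mul _)))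

theorem integral_one_add_sq_mul_hermiteFun_sq (k : ℕ) :
    ∫ x, (1 + x ^ 2) * hermiteFun k x ^ 2 = (k : ℝ) + 3 / 2 := by
  have h := integrable_hermiteFun_mul
  have hcross := (h (k + 1) (k - 1)).const_mul (√(k + 1) * √k)
  have hlow := (h (k - 1) (k - 1)).const_mul ((k : ℝ) / 2)
  have hhigh := (h (k + 1) (k + 1)).const_mul (((k : ℝ) + 1) / 2)
  simp only [sq_mul_hermiteFun_sq]
  rw [integral_add (h k k) (by exact hhigh.add (hcross.add hlow)),
    integral_add hhigh (by exact hcross.add hlow), integral_add hcross hlow]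
  simp only [integral_const_mul, integral_hermiteFun_mul, if_true,
    if_neg (by lia : k + 1 ≠ k - 1)]
  ring

theorem integrable_hermiteFun (k : ℕ) : Integrable (hermiteFun k) :=
  integrable_of_integrable_one_add_sq_mul_sq (continuous_hermiteFun k).aestronglyMeasurable
    (integrable_one_add_sq_mul_hermiteFun_sq k)

theorem integral_abs_hermiteFun_le (k : ℕ) : ∫ x, |hermiteFun k x| ≤ 3 * (k + 1) := by
  have h := two_mul_integral_abs_le (integrable_one_add_sq_mul_hermiteFun_sq k)
  rw [integral_one_add_sq_mul_hermiteFun_sq] at h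
  linarith [Real.pi_lt_four, Nat.cast_nonneg (α := ℝ) k]

theorem norm_exp_I_mul_ofReal (x : ℝ) : ‖Complex.exp (I * x)‖ = 1 := by
  rw [mul_comm, Complex.norm_exp_ofReal_mul_I]

theorem integrable_exp_mul {f : ℝ → ℂ} (hf : Integrable f) (y : ℝ) :
    Integrable fun s : ℝ => Complex.exp (I * ((y * s : ℝ) : ℂ)) * f s :=
  hf.bdd_mul (c := 1) (by fun_prop : Continuous _).aestronglyMeasurable
    (.of_forall fun s => (norm_exp_I_mul_ofReal _).le)

theorem integral_exp_mul_deriv {f f' : ℝ → ℂ} (hderiv : ∀ s, HasDerivAt f (f' s) s)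
    (hf : Integrable f) (hf' : Integrable f') (y : ℝ) :
    ∫ s : ℝ, Complex.exp (I * ((y * s : ℝ) : ℂ)) * f' s =
      -(I * y * ∫ s : ℝ, Complex.exp (I * ((y * s : ℝ) : ℂ)) * f s) := by
  have hexp (s : ℝ) : HasDerivAt (fun s : ℝ => Complex.exp (I * ((y * s : ℝ) : ℂ)))
      (I * y * Complex.exp (I * ((y * s : ℝ) : ℂ))) s := by
    refine ((((hasDerivAt_id' s).const_mul y).ofReal_comp).const_mul I).cexp.congr_deriv ?_
    rw [mul_one, mul_comm]
  have hexp_mul : Integrable fun s : ℝ => I * y * Complex.exp (I * ((y * s : ℝ) : ℂ)) * f s := by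
    simpa only [mul_assoc] using (integrable_exp_mul hf y).const_mul (I * y)
  rw [integral_mul_deriv_eq_deriv_mul_of_integrable (fun s _ => hexp s) (fun s _ => hderiv s)
    (integrable_exp_mul hf' y) hexp_mul (integrable_exp_mul hf y), ← integral_const_mul]
  simp only [mul_assoc]

theorem sqrt_mul_integral_exp_mul_hermiteFun_succ (a : ℕ) (y : ℝ) :
    (√(a + 1) : ℂ) * ∫ s : ℝ, Complex.exp (I * ((y * s : ℝ) : ℂ)) * hermiteFun (a + 1) s =
      √a * (∫ s : ℝ, Complex.exp (I * ((y * s : ℝ) : ℂ)) * hermiteFun (a - 1) s) +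
        I * y * (√2 * ∫ s : ℝ, Complex.exp (I * ((y * s : ℝ) : ℂ)) * hermiteFun a s) := by
  have hint (a : ℕ) : Integrable fun s => (hermiteFun a s : ℂ) := (integrable_hermiteFun a).ofReal
  have hderiv (s : ℝ) : HasDerivAt (fun s => (√2 : ℂ) * hermiteFun a s)
      (√a * hermiteFun (a - 1) s - √(a + 1) * hermiteFun (a + 1) s) s := by
    exact_mod_cast (hasDerivAt_sqrt_two_mul_hermiteFun a s).ofReal_comp
  have hlow := (hint (a - 1)).const_mul (√a : ℂ)
  have hhigh := (hint (a + 1)).const_mul (√(a + 1) : ℂ)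
  have h := integral_exp_mul_deriv hderiv ((hint a).const_mul _) (hlow.sub hhigh) y
  simp only [mul_sub] at h
  rw [integral_sub (integrable_exp_mul hlow y) (integrable_exp_mul hhigh y)] at h
  simp only [mul_left_comm _ (√_ : ℂ) (hermiteFun _ _ : ℂ), integral_const_mul] at h
  linear_combination -h

theorem integral_exp_mul_hermiteFun_zero (y : ℝ) :
    ∫ s : ℝ, Complex.exp (I * ((y * s : ℝ) : ℂ)) * hermiteFun 0 s =
      √(2 * Real.pi) * hermiteFun 0 y := by
  have hgauss (s : ℝ) : Complex.exp (I * ((y * s : ℝ) : ℂ)) * (hermiteFun 0 s : ℂ) =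
      hermiteConst 0 * (Complex.exp (I * y * s) * Complex.exp (-(1 / 2) * (s : ℂ) ^ 2)) := by
    rw [hermiteFun_zero]
    push_cast
    rw [show -((s : ℂ) ^ 2 / 2) = -(1 / 2) * (s : ℂ) ^ 2 by ring, ← mul_assoc I]
    ring
  have hconst : ((Real.pi : ℂ) / (1 / 2)) ^ (1 / 2 : ℂ) = (√(2 * Real.pi) : ℂ) := by
    rw [Real.sqrt_eq_rpow, Complex.ofReal_cpow (by positivity)]
    congr 1 <;> push_cast <;> ring
  simp only [hgauss]
  rw [integral_const_mul, fourierIntegral_gaussian (b := 1 / 2) (by norm_num) (y : ℂ), hconst,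
    hermiteFun_zero]
  push_cast
  rw [show -(y : ℂ) ^ 2 / (4 * (1 / 2)) = -((y : ℂ) ^ 2 / 2) by ring]
  ring

theorem integral_exp_mul_hermiteFun (a : ℕ) (y : ℝ) :
    ∫ s : ℝ, Complex.exp (I * ((y * s : ℝ) : ℂ)) * hermiteFun a s =
      √(2 * Real.pi) * I ^ a * hermiteFun a y := by
  induction a using Nat.strong_induction_on with
  | _ a ih =>
    cases a with
    | zero => simpa using integral_exp_mul_hermiteFun_zero y
    | succ a =>
      have hsqrt : (√(a + 1) : ℂ) ≠ 0 := by
        exact_mod_cast (by positivity : √((a : ℝ) + 1) ≠ 0)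
      have hrec : (√2 : ℂ) * y * hermiteFun a y =
          √(a + 1) * hermiteFun (a + 1) y + √a * hermiteFun (a - 1) y := by
        exact_mod_cast congrArg ((↑) : ℝ → ℂ) (sqrt_two_mul_hermiteFun a y)
      have hpow : (√a : ℂ) * I ^ (a - 1) = -√a * (I ^ a * I) := by
        cases a with
        | zero => simp
        | succ a => simp [pow_succ, mul_assoc]
      refine mul_left_cancel₀ hsqrt ((sqrt_mul_integral_exp_mul_hermiteFun_succ a y).trans ?_)
      rw [ih a (by lia), ih (a - 1) (by lia), pow_succ]
      linear_combination √(2 * Real.pi) * I ^ a * I * hrec +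
        √(2 * Real.pi) * hermiteFun (a - 1) y * hpow

/-! ### Rotations by 45 degrees -/

/-- The product `h_a ⊗ h_b` of Hermite functions in the variables `(y + w)/√2`, `(y - w)/√2`. -/
def rotatedHermite (p : ℕ × ℕ) (y w : ℝ) : ℝ :=
  hermiteFun p.1 ((y + w) / √2) * hermiteFun p.2 ((y - w) / √2)

/-- The action of `a† + ε b†`, where `a†` and `b†` are the creation operators of two independent
variables, on the coefficients `c` of an expansion in products of Hermite functions. -/
def creationCoeff (ε : ℝ) (c : ℕ × ℕ → ℝ) (p : ℕ × ℕ) : ℝ :=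
  √p.1 * c (p.1 - 1, p.2) + ε * (√p.2 * c (p.1, p.2 - 1))

theorem hasDerivAt_rotatedHermite_left (p : ℕ × ℕ) (y w : ℝ) :
    HasDerivAt (fun y => rotatedHermite p y w) (y * rotatedHermite p y w -
      (√(p.1 + 1) * rotatedHermite (p.1 + 1, p.2) y w +
        1 * (√(p.2 + 1) * rotatedHermite (p.1, p.2 + 1) y w))) y := by
  have hs : √2 * √2 = (2 : ℝ) := Real.mul_self_sqrt zero_le_two
  refine (((hasDerivAt_hermiteFun_creation p.1 _).comp y
    (((hasDerivAt_id' y).add_const w).div_const (√2))).mul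
      ((hasDerivAt_hermiteFun_creation p.2 _).comp y
        (((hasDerivAt_id' y).sub_const w).div_const (√2)))).congr_deriv ?_
  simp only [rotatedHermite, Function.comp_apply]
  field_simp
  linear_combination (-y * hermiteFun p.1 ((y + w) / √2) * hermiteFun p.2 ((y - w) / √2)) * hs

theorem hasDerivAt_rotatedHermite_right (p : ℕ × ℕ) (y w : ℝ) :
    HasDerivAt (fun w => rotatedHermite p y w) (w * rotatedHermite p y w -
      (√(p.1 + 1) * rotatedHermite (p.1 + 1, p.2) y w +
        -1 * (√(p.2 + 1) * rotatedHermite (p.1, p.2 + 1) y w))) w := by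
  have hs : √2 * √2 = (2 : ℝ) := Real.mul_self_sqrt zero_le_two
  refine (((hasDerivAt_hermiteFun_creation p.1 _).comp w
    (((hasDerivAt_id' w).const_add y).div_const (√2))).mul
      ((hasDerivAt_hermiteFun_creation p.2 _).comp w
        (((hasDerivAt_id' w).const_sub y).div_const (√2)))).congr_deriv ?_
  simp only [rotatedHermite, Function.comp_apply]
  field_simp
  linear_combination (-w * hermiteFun p.1 ((y + w) / √2) * hermiteFun p.2 ((y - w) / √2)) * hs

theorem sum_antidiagonal_creationCoeff_mul (N : ℕ) (ε : ℝ) (c f : ℕ × ℕ → ℝ) :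
    ∑ p ∈ antidiagonal (N + 1), creationCoeff ε c p * f p =
      ∑ p ∈ antidiagonal N,
        c p * (√(p.1 + 1) * f (p.1 + 1, p.2) + ε * (√(p.2 + 1) * f (p.1, p.2 + 1))) := by
  simp only [creationCoeff, add_mul, mul_add, sum_add_distrib]
  congr 1
  · rw [Nat.sum_antidiagonal_succ]
    simp [mul_left_comm, mul_assoc]
  · rw [Nat.sum_antidiagonal_succ']
    simp [mul_left_comm, mul_assoc]

theorem sqrt_mul_hermiteFun_succ_mul_eq_sum {N k : ℕ} {ε b : ℝ} {c : ℕ × ℕ → ℝ}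
    {f : ℕ × ℕ → ℝ → ℝ}
    (hf : ∀ p v, HasDerivAt (f p) (v * f p v -
      (√(p.1 + 1) * f (p.1 + 1, p.2) v + ε * (√(p.2 + 1) * f (p.1, p.2 + 1) v))) v)
    (hsum : ∀ v, hermiteFun k v * b = ∑ p ∈ antidiagonal N, c p * f p v) (v : ℝ) :
    √2 * √(k + 1) * (hermiteFun (k + 1) v * b) =
      ∑ p ∈ antidiagonal (N + 1), creationCoeff ε c p * f p v := by
  have hleft := (hasDerivAt_hermiteFun_creation k v).mul_const b
  have hright := HasDerivAt.fun_sum fun p (_ : p ∈ antidiagonal N) => (hf p v).const_mul (c p)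
  have heq := hleft.unique (hright.congr_of_eventuallyEq (.of_forall hsum))
  simp only [mul_sub, sum_sub_distrib, mul_left_comm _ v] at heq
  rw [← mul_sum, ← hsum, ← sum_antidiagonal_creationCoeff_mul N ε c (f · v)] at heq
  linear_combination -heq

theorem hermiteFun_zero_mul_hermiteFun_zero (y w : ℝ) :
    hermiteFun 0 y * hermiteFun 0 w = rotatedHermite (0, 0) y w := by
  have hmul (a b : ℝ) : hermiteConst 0 * Real.exp a * (hermiteConst 0 * Real.exp b) =
      hermiteConst 0 ^ 2 * Real.exp (a + b) := by
    rw [Real.exp_add]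
    ring
  simp only [rotatedHermite, hermiteFun_zero]
  rw [hmul, hmul, div_pow, div_pow, Real.sq_sqrt zero_le_two]
  ring_nf

theorem exists_hermiteFun_mul_eq_sum_rotatedHermite (j k : ℕ) : ∃ c : ℕ × ℕ → ℝ, ∀ y w : ℝ,
    hermiteFun k y * hermiteFun j w = ∑ p ∈ antidiagonal (j + k), c p * rotatedHermite p y w := by
  induction j with
  | zero =>
    induction k with
    | zero => exact ⟨fun _ => 1, fun y w => by simp [hermiteFun_zero_mul_hermiteFun_zero]⟩
    | succ k ih =>
      obtain ⟨c, hc⟩ := ih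
      refine ⟨fun p => (√2 * √(k + 1))⁻¹ * creationCoeff 1 c p, fun y w => ?_⟩
      simp only [mul_assoc (_⁻¹)]
      rw [← mul_sum, eq_inv_mul_iff_mul_eq₀ (by positivity)]
      exact sqrt_mul_hermiteFun_succ_mul_eq_sum
        (fun p v => hasDerivAt_rotatedHermite_left p v w) (hc · w) y
  | succ j ih =>
    obtain ⟨c, hc⟩ := ih
    refine ⟨fun p => (√2 * √(j + 1))⁻¹ * creationCoeff (-1) c p, fun y w => ?_⟩
    simp only [mul_assoc (_⁻¹)]
    rw [← mul_sum, eq_inv_mul_iff_mul_eq₀ (by positivity), mul_comm (hermiteFun k y),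
      Nat.add_right_comm]
    exact sqrt_mul_hermiteFun_succ_mul_eq_sum (fun p v => hasDerivAt_rotatedHermite_right p y v)
      (fun v => by rw [mul_comm, hc]) w

/-- The coefficients expressing `h_k ⊗ h_j` through the rotated products `rotatedHermite`; they
form an orthogonal matrix, see `sum_hermiteRotation_mul_hermiteRotation`. -/
def hermiteRotation (j k : ℕ) : ℕ × ℕ → ℝ :=
  (exists_hermiteFun_mul_eq_sum_rotatedHermite j k).choose

theorem hermiteFun_mul_eq_sum_rotatedHermite (j k : ℕ) (y w : ℝ) :
    hermiteFun k y * hermiteFun j w =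
      ∑ p ∈ antidiagonal (j + k), hermiteRotation j k p * rotatedHermite p y w :=
  (exists_hermiteFun_mul_eq_sum_rotatedHermite j k).choose_spec y w

section OrthonormalFunctions

variable {𝕜 κ X : Type*} [RCLike 𝕜] [MeasurableSpace X] {μ : Measure X} {e : κ → X → 𝕜}

theorem memLp_sum_const_mul {p : ENNReal} (he : ∀ i, MemLp (e i) p μ) (s : Finset κ) (a : κ → 𝕜) :
    MemLp (fun x => ∑ i ∈ s, a i * e i x) p μ :=
  memLp_finsetSum s fun i _ => (he i).const_mul (a i)

theorem integral_sum_mul_conj_sum [DecidableEq κ] (he : ∀ i, MemLp (e i) 2 μ)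
    (horth : ∀ i j, ∫ x, e i x * conj (e j x) ∂μ = if i = j then 1 else 0)
    (s t : Finset κ) (a b : κ → 𝕜) :
    ∫ x, (∑ i ∈ s, a i * e i x) * conj (∑ j ∈ t, b j * e j x) ∂μ =
      ∑ i ∈ s ∩ t, a i * conj (b i) := by
  have hint (i j : κ) : Integrable (fun x => a i * conj (b j) * (e i x * conj (e j x))) μ :=
    ((he i).integrable_mul (he j).star).const_mul _
  have hexpand (x : X) : (∑ i ∈ s, a i * e i x) * conj (∑ j ∈ t, b j * e j x) =
      ∑ i ∈ s, ∑ j ∈ t, a i * conj (b j) * (e i x * conj (e j x)) := by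
    simp only [map_sum, map_mul, sum_mul_sum, mul_mul_mul_comm]
  simp only [hexpand]
  rw [integral_finsetSum _ fun i _ => integrable_finsetSum _ fun j _ => hint i j]
  simp only [integral_finsetSum _ fun j _ => hint _ j, integral_const_mul, horth, mul_ite,
    mul_one, mul_zero, sum_ite_eq, sum_ite_mem]

end OrthonormalFunctions

/-- The product Hermite function `h_a ⊗ h_b` on the plane, for `p = (a, b)`. -/
def hermiteFun₂ (p : ℕ × ℕ) (z : ℝ × ℝ) : ℝ := hermiteFun p.1 z.1 * hermiteFun p.2 z.2

@[fun_prop]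
theorem continuous_hermiteFun₂ (p : ℕ × ℕ) : Continuous (hermiteFun₂ p) := by
  unfold hermiteFun₂
  fun_prop

theorem memLp_hermiteFun₂ (p : ℕ × ℕ) : MemLp (hermiteFun₂ p) 2 := by
  refine (memLp_two_iff_integrable_sq (continuous_hermiteFun₂ p).aestronglyMeasurable).2 ?_
  simp only [hermiteFun₂, mul_pow]
  exact (integrable_hermiteFun_sq p.1).mul_prod (integrable_hermiteFun_sq p.2)

theorem integral_hermiteFun₂_mul (p q : ℕ × ℕ) :
    ∫ z, hermiteFun₂ p z * hermiteFun₂ q z = if p = q then 1 else 0 := by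
  simp only [hermiteFun₂, mul_mul_mul_comm]
  refine (integral_prod_mul (fun x => hermiteFun p.1 x * hermiteFun q.1 x)
    (fun x => hermiteFun p.2 x * hermiteFun q.2 x)).trans ?_
  simp only [integral_hermiteFun_mul, Prod.ext_iff, ← ite_and, mul_ite, mul_one, mul_zero, and_comm]

theorem measurePreserving_rotation :
    MeasurePreserving fun z : ℝ × ℝ => ((z.1 + z.2) / √2, (z.1 - z.2) / √2) := by
  let basis := Module.Basis.finTwoProd ℝ
  let rotation := Matrix.toLin basis basis !![(√2)⁻¹, (√2)⁻¹; (√2)⁻¹, -(√2)⁻¹]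
  have hdet : LinearMap.det rotation = -1 := by
    rw [LinearMap.det_toLin, Matrix.det_fin_two_of, mul_neg, ← mul_inv,
      Real.mul_self_sqrt zero_le_two]
    norm_num
  have happly : (fun z : ℝ × ℝ => ((z.1 + z.2) / √2, (z.1 - z.2) / √2)) = rotation := by
    funext z
    rw [Matrix.toLin_finTwoProd_apply]
    ext <;> ring
  rw [happly]
  refine ⟨rotation.continuous_of_finiteDimensional.measurable, ?_⟩
  rw [Measure.map_linearMap_addHaar_eq_smul_addHaar volume (by simp [hdet]), hdet]
  simp

theorem memLp_rotatedHermite (p : ℕ × ℕ) :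
    MemLp (fun z : ℝ × ℝ => rotatedHermite p z.1 z.2) 2 := by
  simpa only [rotatedHermite, Function.comp_def, hermiteFun₂] using
    (memLp_hermiteFun₂ p).comp_measurePreserving measurePreserving_rotation

theorem integral_rotatedHermite_mul (p q : ℕ × ℕ) :
    ∫ z : ℝ × ℝ, rotatedHermite p z.1 z.2 * rotatedHermite q z.1 z.2 = if p = q then 1 else 0 := by
  rw [← integral_hermiteFun₂_mul]
  conv_rhs => rw [← measurePreserving_rotation.map_eq]
  exact (integral_map measurePreserving_rotation.aemeasurable
    (by fun_prop : Continuous fun z => hermiteFun₂ p z * hermiteFun₂ q z).aestronglyMeasurable).symm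

theorem sum_hermiteRotation_mul_hermiteRotation (j k j' k' : ℕ) :
    ∑ p ∈ antidiagonal (j + k) ∩ antidiagonal (j' + k'),
      hermiteRotation j k p * hermiteRotation j' k' p = if j = j' ∧ k = k' then 1 else 0 := by
  have hgram := integral_sum_mul_conj_sum memLp_rotatedHermite
    (by simpa only [conj_trivial] using integral_rotatedHermite_mul) (antidiagonal (j + k))
    (antidiagonal (j' + k')) (hermiteRotation j k) (hermiteRotation j' k')
  simp only [← hermiteFun_mul_eq_sum_rotatedHermite, conj_trivial] at hgram
  rw [← hgram]
  refine (integral_hermiteFun₂_mul (k, j) (k', j')).trans ?_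
  simp only [Prod.mk.injEq, and_comm]

/-! ### Special Hermite functions on the plane -/

/-- The special Hermite function on the plane: the matrix coefficient
`(2π)^{-1/2} (π(x,u) h_k, h_j)` of the Schrödinger representation of the three-dimensional
Heisenberg group. -/
def specialHermite₁ (j k : ℕ) (z : ℝ × ℝ) : ℂ :=
  (√(2 * Real.pi))⁻¹ * ∫ s : ℝ, (hermiteFun j s : ℂ) *
    (Complex.exp (I * ((z.1 * s + 1 / 2 * (z.1 * z.2) : ℝ) : ℂ)) * (hermiteFun k (s + z.2) : ℂ))

/-- The scaled Hermite function `Φ_p^{1/2}` on the plane. -/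
def dilatedHermite (p : ℕ × ℕ) (z : ℝ × ℝ) : ℝ := (√2)⁻¹ * hermiteFun₂ p (z.1 / √2, z.2 / √2)

@[fun_prop]
theorem continuous_dilatedHermite (p : ℕ × ℕ) : Continuous (dilatedHermite p) := by
  unfold dilatedHermite
  fun_prop

theorem integrable_hermiteFun_div_mul (j k : ℕ) :
    Integrable fun x => hermiteFun j (x / √2) * hermiteFun k (x / √2) :=
  (integrable_hermiteFun_mul j k).comp_div (by positivity)

theorem integral_hermiteFun_div_mul (j k : ℕ) :
    ∫ x, hermiteFun j (x / √2) * hermiteFun k (x / √2) = √2 * if j = k then 1 else 0 := by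
  rw [Measure.integral_comp_div (fun x => hermiteFun j x * hermiteFun k x),
    integral_hermiteFun_mul, abs_of_pos (by positivity), smul_eq_mul]

theorem dilatedHermite_mul_dilatedHermite (p q : ℕ × ℕ) (z : ℝ × ℝ) :
    dilatedHermite p z * dilatedHermite q z =
      (1 / 2) * ((hermiteFun p.1 (z.1 / √2) * hermiteFun q.1 (z.1 / √2)) *
        (hermiteFun p.2 (z.2 / √2) * hermiteFun q.2 (z.2 / √2))) := by
  have hs : (√2)⁻¹ * (√2)⁻¹ = (1 / 2 : ℝ) := by
    rw [← mul_inv, Real.mul_self_sqrt zero_le_two, one_div]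
  rw [← hs, dilatedHermite, dilatedHermite, hermiteFun₂, hermiteFun₂]
  ring

theorem memLp_dilatedHermite (p : ℕ × ℕ) : MemLp (fun z => (dilatedHermite p z : ℂ)) 2 := by
  refine MemLp.ofReal ?_
  refine (memLp_two_iff_integrable_sq (continuous_dilatedHermite p).aestronglyMeasurable).2 ?_
  simp only [pow_two, dilatedHermite_mul_dilatedHermite]
  exact ((integrable_hermiteFun_div_mul _ _).mul_prod
    (integrable_hermiteFun_div_mul _ _)).const_mul _

theorem integral_dilatedHermite_mul (p q : ℕ × ℕ) :
    ∫ z, (dilatedHermite p z : ℂ) * conj (dilatedHermite q z : ℂ) = if p = q then 1 else 0 := by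
  have hs : √2 * √2 = (2 : ℝ) := Real.mul_self_sqrt zero_le_two
  have hreal : ∫ z, dilatedHermite p z * dilatedHermite q z = if p = q then 1 else 0 := by
    simp only [dilatedHermite_mul_dilatedHermite]
    rw [integral_const_mul]
    refine (congrArg _ (integral_prod_mul
      (fun x => hermiteFun p.1 (x / √2) * hermiteFun q.1 (x / √2))
      (fun x => hermiteFun p.2 (x / √2) * hermiteFun q.2 (x / √2)))).trans ?_
    rw [integral_hermiteFun_div_mul, integral_hermiteFun_div_mul, mul_mul_mul_comm, hs,
      ← mul_assoc, one_div_mul_cancel two_ne_zero, one_mul]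
    simp only [Prod.ext_iff, ← ite_and, mul_ite, mul_one, mul_zero, and_comm]
  simp only [Complex.conj_ofReal, ← Complex.ofReal_mul]
  rw [integral_complex_ofReal, hreal]
  split_ifs <;> simp

-- Centring the integration at `s - u/2` makes the phase linear and turns the two Hermite functions
-- into a product in variables rotated by 45 degrees.
theorem hermiteFun_mul_exp_mul_hermiteFun (j k : ℕ) (x u s : ℝ) :
    (hermiteFun j (s - u / 2) : ℂ) *
        (Complex.exp (I * ((x * (s - u / 2) + 1 / 2 * (x * u) : ℝ) : ℂ)) *
          hermiteFun k (s - u / 2 + u)) =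
      ∑ p ∈ antidiagonal (j + k), ((hermiteRotation j k p : ℂ) * hermiteFun p.2 (u / √2)) *
        (Complex.exp (I * ((x / √2 * (√2 * s) : ℝ) : ℂ)) * hermiteFun p.1 (√2 * s)) := by
  have hs : √2 * √2 = (2 : ℝ) := Real.mul_self_sqrt zero_le_two
  have hsum : (s - u / 2 + u + (s - u / 2)) / √2 = √2 * s := by
    rw [div_eq_iff (by positivity)]
    linear_combination -s * hs
  have hdiff : (s - u / 2 + u - (s - u / 2)) / √2 = u / √2 := by ring
  have hphase : x * (s - u / 2) + 1 / 2 * (x * u) = x / √2 * (√2 * s) := by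
    field_simp
    ring
  have hprod := congrArg ((↑) : ℝ → ℂ)
    (hermiteFun_mul_eq_sum_rotatedHermite j k (s - u / 2 + u) (s - u / 2))
  simp only [rotatedHermite, hsum, hdiff, Complex.ofReal_mul, Complex.ofReal_sum] at hprod
  rw [hphase, mul_left_comm, mul_comm (hermiteFun j _ : ℂ), hprod, mul_sum]
  refine sum_congr rfl fun p _ => ?_
  ring

theorem specialHermite₁_eq_sum (j k : ℕ) (z : ℝ × ℝ) :
    specialHermite₁ j k z =
      ∑ p ∈ antidiagonal (j + k), hermiteRotation j k p * I ^ p.1 * dilatedHermite p z := by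
  have hs : 0 < √2 := by positivity
  have hs' : (√2 : ℂ) ≠ 0 := by exact_mod_cast hs.ne'
  have hpi : (√Real.pi : ℂ) ≠ 0 := by exact_mod_cast (by positivity : √Real.pi ≠ 0)
  let wave (a : ℕ) (s : ℝ) : ℂ := Complex.exp (I * ((z.1 / √2 * s : ℝ) : ℂ)) * hermiteFun a s
  have hint (a : ℕ) : Integrable fun s => wave a (√2 * s) :=
    (integrable_exp_mul (integrable_hermiteFun a).ofReal (z.1 / √2)).comp_mul_left' hs.ne'
  have hwave (a : ℕ) : ∫ s, wave a (√2 * s) =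
      (√2)⁻¹ * (√(2 * Real.pi) * I ^ a * hermiteFun a (z.1 / √2)) := by
    rw [Measure.integral_comp_mul_left (wave a), integral_exp_mul_hermiteFun,
      abs_of_pos (inv_pos.2 hs), Complex.real_smul, Complex.ofReal_inv]
  rw [specialHermite₁, ← integral_sub_right_eq_self _ (z.2 / 2)]
  simp only [hermiteFun_mul_exp_mul_hermiteFun]
  rw [integral_finsetSum _ fun p _ => (hint p.1).const_mul _, mul_sum]
  refine sum_congr rfl fun p _ => ?_
  rw [integral_const_mul, hwave, dilatedHermite, hermiteFun₂, Real.sqrt_mul zero_le_two]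
  push_cast
  field_simp

@[fun_prop]
theorem continuous_specialHermite₁ (j k : ℕ) : Continuous (specialHermite₁ j k) := by
  simp only [funext (specialHermite₁_eq_sum j k)]
  fun_prop

theorem memLp_specialHermite₁ (j k : ℕ) : MemLp (specialHermite₁ j k) 2 := by
  simp only [funext (specialHermite₁_eq_sum j k)]
  exact memLp_sum_const_mul memLp_dilatedHermite _ _

theorem integral_specialHermite₁_mul_conj (j k j' k' : ℕ) :
    ∫ z, specialHermite₁ j k z * conj (specialHermite₁ j' k' z) =
      if j = j' ∧ k = k' then 1 else 0 := by
  have hphase (a b : ℝ) (m : ℕ) : (a : ℂ) * I ^ m * conj ((b : ℂ) * I ^ m) = (a * b : ℝ) := by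
    have hI : I ^ m * conj I ^ m = 1 := by simp [← mul_pow]
    rw [map_mul, map_pow, Complex.conj_ofReal, mul_mul_mul_comm, hI, mul_one, Complex.ofReal_mul]
  simp only [specialHermite₁_eq_sum]
  rw [integral_sum_mul_conj_sum memLp_dilatedHermite integral_dilatedHermite_mul]
  simp only [hphase]
  rw [← Complex.ofReal_sum, sum_hermiteRotation_mul_hermiteRotation]
  split_ifs <;> simp

theorem integral_specialHermite₁_mul_dilatedHermite_eq_zero {j k : ℕ} {q : ℕ × ℕ}
    (hq : q.1 + q.2 ≠ j + k) :
    ∫ z, specialHermite₁ j k z * (dilatedHermite q z : ℂ) = 0 := by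
  have hgram := integral_sum_mul_conj_sum memLp_dilatedHermite integral_dilatedHermite_mul
    (antidiagonal (j + k)) {q} (fun p => hermiteRotation j k p * I ^ p.1) 1
  rw [inter_singleton_of_notMem (by simpa using hq), sum_empty] at hgram
  simpa [specialHermite₁_eq_sum] using hgram

/-! ### Completeness of the Hermite functions -/

section Moments

theorem integral_exp_I_mul_eq_zero_of_moments {X : Type*} [MeasurableSpace X] {μ : Measure X}
    {u : X → ℝ} {g : X → ℂ} (hu : AEStronglyMeasurable u μ) (hg : AEStronglyMeasurable g μ)
    (hexp : Integrable (fun x => Real.exp |u x| * ‖g x‖) μ)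
    (hmoments : ∀ m : ℕ, ∫ x, (u x : ℂ) ^ m * g x ∂μ = 0) :
    ∫ x, Complex.exp (I * u x) * g x ∂μ = 0 := by
  have hseries (x : X) : HasSum (fun m : ℕ => |u x| ^ m / m.factorial * ‖g x‖)
      (Real.exp |u x| * ‖g x‖) := by
    rw [Real.exp_eq_exp_ℝ]
    exact (NormedSpace.expSeries_div_hasSum_exp |u x|).mul_right _
  have hcseries (x : X) : HasSum (fun m : ℕ => I ^ m / m.factorial * ((u x : ℂ) ^ m * g x))
      (Complex.exp (I * u x) * g x) := by
    rw [Complex.exp_eq_exp_ℂ]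
    simpa only [mul_pow, mul_div_right_comm, mul_assoc] using
      (NormedSpace.expSeries_div_hasSum_exp (I * (u x : ℂ))).mul_right (g x)
  have hmeas (m : ℕ) : AEStronglyMeasurable (fun x => I ^ m / m.factorial * ((u x : ℂ) ^ m * g x))
      μ := by fun_prop
  have hbound (m : ℕ) (x : X) :
      ‖I ^ m / m.factorial * ((u x : ℂ) ^ m * g x)‖ ≤ |u x| ^ m / m.factorial * ‖g x‖ := by
    simp [div_mul_eq_mul_div]
  have hdominated : Integrable (fun x => ∑' m : ℕ, |u x| ^ m / m.factorial * ‖g x‖) μ := by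
    simpa only [(hseries _).tsum_eq] using hexp
  have hsum := hasSum_integral_of_dominated_convergence
    (F := fun (m : ℕ) x => I ^ m / m.factorial * ((u x : ℂ) ^ m * g x))
    (fun m x => |u x| ^ m / m.factorial * ‖g x‖) hmeas
    (fun m => .of_forall (hbound m)) (.of_forall fun x => (hseries x).summable) hdominated
    (.of_forall hcseries)
  simp only [integral_const_mul, hmoments, mul_zero] at hsum
  exact hsum.unique hasSum_zero

variable {V : Type*} [NormedAddCommGroup V] [InnerProductSpace ℝ V] [FiniteDimensional ℝ V]
  [MeasurableSpace V] [BorelSpace V]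

open FourierTransform in
theorem ae_eq_zero_of_fourier_eq_zero {f : V → ℂ} (hf : Integrable f) (hfourier : ∀ w, 𝓕 f w = 0) :
    f =ᵐ[volume] 0 := by
  refine ae_eq_zero_of_integral_contDiff_smul_eq_zero hf.locallyIntegrable fun g hg hc => ?_
  have hsupp : HasCompactSupport (Complex.ofRealCLM ∘ g) := hc.comp_left rfl
  let ψ : SchwartzMap V ℂ := 𝓕⁻ (hsupp.toSchwartzMap (by fun_prop))
  have hψ (x : V) : 𝓕 (ψ : V → ℂ) x = g x := by
    rw [← SchwartzMap.fourier_coe, FourierTransform.fourier_fourierInv_eq]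
    rfl
  calc ∫ x, g x • f x = ∫ x, 𝓕 (ψ : V → ℂ) x • f x := by
        simp only [hψ, smul_eq_mul, Complex.real_smul]
    _ = ∫ x, ψ x • 𝓕 f x := by
        have hflip := VectorFourier.integral_fourierIntegral_smul_eq_flip (L := innerₗ V)
          Real.continuous_fourierChar continuous_inner ψ.integrable hf (μ := volume) (ν := volume)
        rwa [flip_innerₗ] at hflip
    _ = 0 := by simp only [hfourier, smul_zero, integral_zero]

theorem ae_eq_zero_of_moments {g : V → ℂ} (hg : AEStronglyMeasurable g)
    (hexp : ∀ y : V, Integrable fun x => Real.exp |⟪y, x⟫_ℝ| * ‖g x‖)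
    (hmoments : ∀ (y : V) (m : ℕ), ∫ x, (⟪y, x⟫_ℝ : ℂ) ^ m * g x = 0) : g =ᵐ[volume] 0 := by
  have hint : Integrable g := by
    rw [← integrable_norm_iff hg]
    simpa using hexp 0
  refine ae_eq_zero_of_fourier_eq_zero hint fun w => ?_
  let y : V := (-2 * Real.pi) • w
  have hvanish := integral_exp_I_mul_eq_zero_of_moments
    (by fun_prop : Continuous fun x => ⟪y, x⟫_ℝ).aestronglyMeasurable hg (hexp y) (hmoments y)
  rw [Real.fourier_eq', ← hvanish]
  congr 1 with x
  rw [smul_eq_mul, real_inner_smul_left, real_inner_comm x w, mul_comm I]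

end Moments

section HermiteBasis

variable {ι : Type} [Fintype ι]

theorem integral_euclideanSpace_prod {𝕜 : Type*} [RCLike 𝕜] (f : ι → ℝ → 𝕜) :
    ∫ x : EuclideanSpace ℝ ι, ∏ i, f i (x i) = ∏ i, ∫ s, f i s := by
  rw [← integral_fintype_prod_volume_eq_prod]
  exact (EuclideanSpace.volume_preserving_symm_measurableEquiv_toLp ι).integral_comp'
    (fun y : ι → ℝ => ∏ i, f i (y i))

theorem integrable_euclideanSpace_prod {𝕜 : Type*} [RCLike 𝕜] {f : ι → ℝ → 𝕜}
    (hf : ∀ i, Integrable (f i)) :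
    Integrable fun x : EuclideanSpace ℝ ι => ∏ i, f i (x i) :=
  ((EuclideanSpace.volume_preserving_symm_measurableEquiv_toLp ι).integrable_comp_emb
    (MeasurableEquiv.measurableEmbedding _)).2 (Integrable.fintype_prod hf)

@[fun_prop]
theorem continuous_scaledHermite (lam : ℝ) (α : ι → ℕ) : Continuous (scaledHermite lam α) :=
  (contDiff_scaledHermite (m := 0) lam α).continuous

theorem integral_hermiteFun_mul_left_mul {a : ℝ} (ha : 0 < a) (j k : ℕ) :
    ∫ s, hermiteFun j (a * s) * hermiteFun k (a * s) = a⁻¹ * if j = k then 1 else 0 := by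
  rw [Measure.integral_comp_mul_left (fun s => hermiteFun j s * hermiteFun k s),
    integral_hermiteFun_mul, abs_of_pos (inv_pos.2 ha), smul_eq_mul]

theorem integral_scaledHermite_mul {lam : ℝ} (hlam : lam ≠ 0) (α β : ι → ℕ) :
    ∫ x, scaledHermite lam α x * scaledHermite lam β x = if α = β then 1 else 0 := by
  have hnormalization :
      (|lam| ^ ((Fintype.card ι : ℝ) / 4)) ^ 2 * (√|lam|)⁻¹ ^ Fintype.card ι = 1 := by
    rw [← Real.rpow_natCast, ← Real.rpow_natCast, Real.sqrt_eq_rpow, ← Real.rpow_neg (abs_nonneg _),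
      ← Real.rpow_mul (abs_nonneg _), ← Real.rpow_mul (abs_nonneg _),
      ← Real.rpow_add (abs_pos.2 hlam)]
    convert Real.rpow_zero _ using 2
    push_cast
    ring
  simp only [scaledHermite, mul_mul_mul_comm _ (∏ _, _), ← prod_mul_distrib, ← pow_two]
  rw [integral_const_mul, integral_euclideanSpace_prod fun i s =>
    hermiteFun (α i) (√|lam| * s) * hermiteFun (β i) (√|lam| * s)]
  simp only [integral_hermiteFun_mul_left_mul (Real.sqrt_pos.2 (abs_pos.2 hlam))]
  rw [prod_mul_distrib, prod_const, card_univ, ← mul_assoc, hnormalization, one_mul, prod_ite_zero]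
  simp [funext_iff]

theorem coeFn_hermiteL2 {lam : ℝ} (hlam : lam ≠ 0) (α : ι → ℕ) :
    hermiteL2 lam hlam α =ᵐ[volume] fun x => (scaledHermite lam α x : ℂ) :=
  MemLp.coeFn_toLp _

theorem inner_hermiteL2_left {lam : ℝ} (hlam : lam ≠ 0) (α : ι → ℕ) (f : L2 ι) :
    ⟪hermiteL2 lam hlam α, f⟫_ℂ = ∫ x, (scaledHermite lam α x : ℂ) * f x := by
  rw [L2.inner_def]
  refine integral_congr_ae ?_
  filter_upwards [coeFn_hermiteL2 hlam α] with x hx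
  rw [hx, RCLike.inner_apply, Complex.conj_ofReal, mul_comm]

theorem orthonormal_hermiteL2 {lam : ℝ} (hlam : lam ≠ 0) :
    Orthonormal ℂ (hermiteL2 (ι := ι) lam hlam) := by
  classical
  refine orthonormal_iff_ite.2 fun α β => ?_
  have hreal : ∫ x, (scaledHermite lam α x : ℂ) * hermiteL2 lam hlam β x =
      ∫ x, ((scaledHermite lam α x * scaledHermite lam β x : ℝ) : ℂ) := by
    refine integral_congr_ae ?_
    filter_upwards [coeFn_hermiteL2 hlam β] with x hx
    rw [hx, Complex.ofReal_mul]
  rw [inner_hermiteL2_left, hreal, integral_complex_ofReal, integral_scaledHermite_mul hlam]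
  split_ifs <;> simp

theorem scaledHermite_update [DecidableEq ι] (lam : ℝ) (α : ι → ℕ) (i : ι) (k : ℕ)
    (x : EuclideanSpace ℝ ι) :
    scaledHermite lam (Function.update α i k) x =
      |lam| ^ ((Fintype.card ι : ℝ) / 4) * (hermiteFun k (√|lam| * x i) *
        ∏ j ∈ univ.erase i, hermiteFun (α j) (√|lam| * x j)) := by
  rw [scaledHermite, ← mul_prod_erase univ _ (mem_univ i), Function.update_self]
  congr 2
  refine prod_congr rfl fun j hj => ?_
  rw [Function.update_of_ne (ne_of_mem_erase hj)]

theorem coord_mul_scaledHermite [DecidableEq ι] {lam : ℝ} (hlam : lam ≠ 0) (α : ι → ℕ) (i : ι)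
    (x : EuclideanSpace ℝ ι) :
    x i * scaledHermite lam α x = (√2 * √|lam|)⁻¹ *
      (√(α i + 1) * scaledHermite lam (Function.update α i (α i + 1)) x +
        √(α i) * scaledHermite lam (Function.update α i (α i - 1)) x) := by
  have hself := scaledHermite_update lam α i (α i) x
  rw [Function.update_eq_self] at hself
  rw [hself, scaledHermite_update, scaledHermite_update,
    eq_inv_mul_iff_mul_eq₀ (by positivity)]
  linear_combination (|lam| ^ ((Fintype.card ι : ℝ) / 4) *
    ∏ j ∈ univ.erase i, hermiteFun (α j) (√|lam| * x j)) *
    sqrt_two_mul_hermiteFun (α i) (√|lam| * x i)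

theorem inner_mul_scaledHermite [DecidableEq ι] {lam : ℝ} (hlam : lam ≠ 0) (α : ι → ℕ)
    (x y : EuclideanSpace ℝ ι) :
    ⟪y, x⟫_ℝ * scaledHermite lam α x = ∑ i, y i * ((√2 * √|lam|)⁻¹ *
      (√(α i + 1) * scaledHermite lam (Function.update α i (α i + 1)) x +
        √(α i) * scaledHermite lam (Function.update α i (α i - 1)) x)) := by
  simp only [← coord_mul_scaledHermite hlam, PiLp.inner_apply, RCLike.inner_apply, conj_trivial,
    sum_mul, mul_left_comm, mul_assoc]

theorem integral_inner_pow_mul_scaledHermite_mul_eq_zero {lam : ℝ} (hlam : lam ≠ 0) {f : L2 ι}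
    (hf : ∀ α, ⟪hermiteL2 lam hlam α, f⟫_ℂ = 0) (y : EuclideanSpace ℝ ι) (m : ℕ) (α : ι → ℕ) :
    Integrable (fun x => (⟪y, x⟫_ℝ : ℂ) ^ m * ((scaledHermite lam α x : ℂ) * f x)) ∧
      ∫ x, (⟪y, x⟫_ℝ : ℂ) ^ m * ((scaledHermite lam α x : ℂ) * f x) = 0 := by
  classical
  induction m generalizing α with
  | zero =>
    simp only [pow_zero, one_mul]
    exact ⟨(memLp_scaledHermite lam hlam α).integrable_mul (Lp.memLp f),
      by rw [← inner_hermiteL2_left hlam, hf]⟩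
  | succ m ih =>
    let raised (i : ι) := Function.update α i (α i + 1)
    let lowered (i : ι) := Function.update α i (α i - 1)
    let moment (β : ι → ℕ) (x : EuclideanSpace ℝ ι) : ℂ :=
      (⟪y, x⟫_ℝ : ℂ) ^ m * ((scaledHermite lam β x : ℂ) * f x)
    have hexpand (x : EuclideanSpace ℝ ι) :
        (⟪y, x⟫_ℝ : ℂ) ^ (m + 1) * ((scaledHermite lam α x : ℂ) * f x) =
          ∑ i, ((y i * (√2 * √|lam|)⁻¹ : ℝ) : ℂ) *
            ((√(α i + 1) : ℂ) * moment (raised i) x + (√(α i) : ℂ) * moment (lowered i) x) := by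
      rw [pow_succ', mul_assoc, mul_left_comm _ (scaledHermite lam α x : ℂ), ← mul_assoc,
        ← Complex.ofReal_mul, inner_mul_scaledHermite hlam, Complex.ofReal_sum, sum_mul]
      refine sum_congr rfl fun i _ => ?_
      simp only [moment, raised, lowered]
      push_cast
      ring
    have hraised (i : ι) := (ih (raised i)).1.const_mul (√(α i + 1) : ℂ)
    have hlowered (i : ι) := (ih (lowered i)).1.const_mul (√(α i) : ℂ)
    have hterm (i : ι) := ((hraised i).fun_add (hlowered i)).const_mul
      ((y i * (√2 * √|lam|)⁻¹ : ℝ) : ℂ)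
    simp only [hexpand]
    refine ⟨integrable_finsetSum _ fun i _ => hterm i, ?_⟩
    rw [integral_finsetSum _ fun i _ => hterm i]
    refine sum_eq_zero fun i _ => ?_
    rw [integral_const_mul, integral_add (hraised i) (hlowered i), integral_const_mul,
      integral_const_mul, (ih _).2, (ih _).2, mul_zero, mul_zero, add_zero, mul_zero]

theorem scaledHermite_zero (lam : ℝ) (x : EuclideanSpace ℝ ι) :
    scaledHermite lam 0 x = |lam| ^ ((Fintype.card ι : ℝ) / 4) *
      hermiteConst 0 ^ Fintype.card ι * Real.exp (-(|lam| / 2 * ‖x‖ ^ 2)) := by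
  simp only [scaledHermite, Pi.zero_apply, hermiteFun_zero]
  rw [prod_mul_distrib, prod_const, card_univ, ← Real.exp_sum, mul_assoc,
    EuclideanSpace.norm_sq_eq, mul_sum, ← sum_neg_distrib]
  simp only [mul_pow, Real.sq_sqrt (abs_nonneg _), Real.norm_eq_abs, sq_abs, div_mul_eq_mul_div]

theorem scaledHermite_zero_pos {lam : ℝ} (hlam : lam ≠ 0) (x : EuclideanSpace ℝ ι) :
    0 < scaledHermite lam 0 x := by
  have hconst : 0 < hermiteConst 0 := by
    unfold hermiteConst
    positivity
  rw [scaledHermite_zero]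
  positivity

theorem memLp_exp_abs_inner_mul_scaledHermite {lam : ℝ} (hlam : lam ≠ 0)
    (y : EuclideanSpace ℝ ι) :
    MemLp (fun x => Real.exp |⟪y, x⟫_ℝ| * scaledHermite lam 0 x) 2 := by
  have hcont : Continuous fun x => Real.exp |⟪y, x⟫_ℝ| * scaledHermite lam 0 x := by fun_prop
  let const := |lam| ^ ((Fintype.card ι : ℝ) / 4) * hermiteConst 0 ^ Fintype.card ι
  have hgaussian (c : ℝ) : Integrable fun x : EuclideanSpace ℝ ι =>
      Real.exp (-|lam| * ‖x‖ ^ 2 + c * ⟪y, x⟫_ℝ) := by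
    refine (GaussianFourier.integrable_cexp_neg_mul_sq_norm_add (b := ((|lam| : ℝ) : ℂ))
      (by simpa using hlam) (c : ℂ) y).norm.congr (.of_forall fun x => ?_)
    simp [Complex.norm_exp, ← Complex.ofReal_pow]
  rw [memLp_two_iff_integrable_sq hcont.aestronglyMeasurable]
  refine (((hgaussian 2).add (hgaussian (-2))).const_mul (const ^ 2)).mono'
    (hcont.pow 2).aestronglyMeasurable (.of_forall fun x => ?_)
  have hsq : (Real.exp |⟪y, x⟫_ℝ| * scaledHermite lam 0 x) ^ 2 =
      const ^ 2 * Real.exp (-|lam| * ‖x‖ ^ 2 + |2 * ⟪y, x⟫_ℝ|) := by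
    rw [scaledHermite_zero, mul_pow, mul_pow, ← Real.exp_nat_mul, ← Real.exp_nat_mul,
      mul_left_comm, ← Real.exp_add, abs_mul, abs_two]
    congr 2
    push_cast
    ring
  rw [Real.norm_of_nonneg (sq_nonneg _), hsq]
  refine mul_le_mul_of_nonneg_left ?_ (sq_nonneg _)
  simp only [Pi.add_apply]
  rcases abs_choice (2 * ⟪y, x⟫_ℝ) with h | h <;> rw [h]
  · exact le_add_of_nonneg_right (Real.exp_pos _).le
  · rw [neg_mul 2]
    exact le_add_of_nonneg_left (Real.exp_pos _).le

theorem eq_zero_of_inner_hermiteL2_eq_zero {lam : ℝ} (hlam : lam ≠ 0) {f : L2 ι}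
    (hf : ∀ α, ⟪hermiteL2 lam hlam α, f⟫_ℂ = 0) : f = 0 := by
  have hmeas : AEStronglyMeasurable fun x => (scaledHermite lam 0 x : ℂ) * f x :=
    (memLp_scaledHermite lam hlam 0).1.mul (Lp.aestronglyMeasurable f)
  have hexp (y : EuclideanSpace ℝ ι) :
      Integrable fun x => Real.exp |⟪y, x⟫_ℝ| * ‖(scaledHermite lam 0 x : ℂ) * f x‖ := by
    refine ((memLp_exp_abs_inner_mul_scaledHermite hlam y).norm.integrable_mul
      (Lp.memLp f).norm).congr (.of_forall fun x => ?_)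
    simp [mul_assoc]
  have hzero := ae_eq_zero_of_moments hmeas hexp fun y m =>
    (integral_inner_pow_mul_scaledHermite_mul_eq_zero hlam hf y m 0).2
  rw [Lp.eq_zero_iff_ae_eq_zero]
  filter_upwards [hzero] with x hx
  exact (mul_eq_zero.1 hx).resolve_left (by exact_mod_cast (scaledHermite_zero_pos hlam x).ne')

/-- The scaled Hermite functions as a Hilbert basis of `L²(ℝ^ι)`. -/
def hermiteBasis {lam : ℝ} (hlam : lam ≠ 0) : HilbertBasis (ι → ℕ) ℂ (L2 ι) :=
  HilbertBasis.mkOfOrthogonalEqBot (orthonormal_hermiteL2 hlam) <|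
    (Submodule.eq_bot_iff _).2 fun f hf => eq_zero_of_inner_hermiteL2_eq_zero hlam fun α =>
      (Submodule.mem_orthogonal _ f).1 hf _ (Submodule.subset_span ⟨α, rfl⟩)

@[simp]
theorem coe_hermiteBasis {lam : ℝ} (hlam : lam ≠ 0) :
    ⇑(hermiteBasis (ι := ι) hlam) = hermiteL2 lam hlam :=
  HilbertBasis.coe_mkOfOrthogonalEqBot _ _

end HermiteBasis

/-! ### The Poisson–Hermite semigroup -/

section OrthonormalSeries

variable {𝕜 E κ : Type*} [RCLike 𝕜] [NormedAddCommGroup E] [InnerProductSpace 𝕜 E] {v : κ → E}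

theorem inner_eq_of_hasSum_smul (hv : Orthonormal 𝕜 v) {c : κ → 𝕜} {f : E}
    (hf : HasSum (fun i => c i • v i) f) (i : κ) : ⟪v i, f⟫_𝕜 = c i := by
  have hinner : HasSum (fun j => ⟪v i, c j • v j⟫_𝕜) ⟪v i, f⟫_𝕜 := hf.mapL (innerSL 𝕜 (v i))
  have hsingle := hasSum_single (f := fun j => ⟪v i, c j • v j⟫_𝕜) i fun j hj => by
    rw [inner_smul_right, hv.2 hj.symm, mul_zero]
  rw [hinner.unique hsingle, inner_smul_right, inner_self_eq_norm_sq_to_K, hv.1]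
  simp

theorem exists_inner_eq_of_summable_norm_sq [CompleteSpace E] (hv : Orthonormal 𝕜 v) {c : κ → 𝕜}
    (hc : Summable fun i => ‖c i‖ ^ 2) : ∃ f : E, ∀ i, ⟪v i, f⟫_𝕜 = c i := by
  have hsum : Summable fun i => c i • v i := by
    simpa using (hv.orthogonalFamily.summable_iff_norm_sq_summable c).2 hc
  exact ⟨_, inner_eq_of_hasSum_smul hv hsum.hasSum⟩

end OrthonormalSeries

section PoissonHermite

variable {ι : Type} [Fintype ι] {t lam : ℝ} {hlam : lam ≠ 0} {g f : L2 ι}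

theorem isPoissonHermite_iff_inner_eq : IsPoissonHermite t lam hlam g f ↔
    ∀ α, ⟪hermiteL2 lam hlam α, f⟫_ℂ =
      (Real.exp (-(t * √(hermiteEigenvalue lam α))) : ℂ) * ⟪hermiteL2 lam hlam α, g⟫_ℂ := by
  refine ⟨inner_eq_of_hasSum_smul (orthonormal_hermiteL2 hlam), fun h => ?_⟩
  have hexpansion := (hermiteBasis hlam).hasSum_repr f
  simp only [HilbertBasis.repr_apply_apply, coe_hermiteBasis, h] at hexpansion
  exact hexpansion

theorem exists_isPoissonHermite (ht : 0 ≤ t) (hlam : lam ≠ 0) (g : L2 ι) :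
    ∃ f, IsPoissonHermite t lam hlam g f := by
  simp only [isPoissonHermite_iff_inner_eq]
  have horth := orthonormal_hermiteL2 (ι := ι) hlam
  refine exists_inner_eq_of_summable_norm_sq horth <|
    (horth.inner_products_summable g).of_nonneg_of_le (fun α => by positivity) fun α => ?_
  have hexp : Real.exp (-(t * √(hermiteEigenvalue lam α))) ≤ 1 :=
    Real.exp_le_one_iff.2 (neg_nonpos.2 (by positivity))
  rw [norm_mul, Complex.norm_real, Real.norm_of_nonneg (Real.exp_pos _).le]
  gcongr
  exact mul_le_of_le_one_left (norm_nonneg _) hexp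

theorem mem_poissonHermiteSpace_iff_summable : f ∈ poissonHermiteSpace ι t lam hlam ↔
    Summable fun α => (Real.exp (t * √(hermiteEigenvalue lam α)) *
      ‖⟪hermiteL2 lam hlam α, f⟫_ℂ‖) ^ 2 := by
  have horth := orthonormal_hermiteL2 (ι := ι) hlam
  constructor
  · rintro ⟨g, hg⟩
    convert horth.inner_products_summable g using 3 with α
    rw [isPoissonHermite_iff_inner_eq.1 hg, norm_mul, Complex.norm_real,
      Real.norm_of_nonneg (Real.exp_pos _).le, ← mul_assoc, ← Real.exp_add, add_neg_cancel,
      Real.exp_zero, one_mul]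
  · intro hsum
    obtain ⟨g, hg⟩ := exists_inner_eq_of_summable_norm_sq horth (c := fun α =>
      (Real.exp (t * √(hermiteEigenvalue lam α)) : ℂ) * ⟪hermiteL2 lam hlam α, f⟫_ℂ)
      (by simpa only [norm_mul, Complex.norm_real, Real.norm_of_nonneg (Real.exp_pos _).le]
        using hsum)
    refine ⟨g, isPoissonHermite_iff_inner_eq.2 fun α => ?_⟩
    rw [hg, ← mul_assoc, ← Complex.ofReal_mul, ← Real.exp_add, neg_add_cancel, Real.exp_zero,
      Complex.ofReal_one, one_mul]

end PoissonHermite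

section Integrability

theorem integrable_of_hasSum_Lp {X E κ : Type*} [MeasurableSpace X] {μ : Measure X}
    [NormedAddCommGroup E] [CompleteSpace E] [Countable κ] {p : ENNReal} [Fact (1 ≤ p)]
    {v : κ → Lp E p μ} {f : Lp E p μ} (hf : HasSum v f) (hint : ∀ i, Integrable (v i) μ)
    (hsum : Summable fun i => ∫ x, ‖v i x‖ ∂μ) : Integrable f μ := by
  have hL1 : Summable fun i => (hint i).toL1 (v i) := by
    refine .of_norm (hsum.congr fun i => ?_)
    rw [L1.norm_eq_integral_norm]
    exact integral_congr_ae ((hint i).coeFn_toL1.fun_comp norm).symm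
  have hpartial (s : Finset κ) : (∑ i ∈ s, (hint i).toL1 (v i) : Lp E 1 μ) =ᵐ[μ]
      (∑ i ∈ s, v i : Lp E p μ) := by
    filter_upwards [Lp.coeFn_fun_finsetSum s fun i => (hint i).toL1 (v i),
      Lp.coeFn_fun_finsetSum s v, ae_all_iff.2 fun i => (hint i).coeFn_toL1] with x hx₁ hx hcoe
    rw [hx₁, hx]
    exact sum_congr rfl fun i _ => hcoe i
  -- Both series converge in measure, and limits in measure are unique.
  have hmeasure := tendstoInMeasure_of_tendsto_Lp hL1.hasSum
  exact (L1.integrable_coeFn _).congr <|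
    tendstoInMeasure_ae_unique (hmeasure.congr_left hpartial) (tendstoInMeasure_of_tendsto_Lp hf)

variable {ι : Type} [Fintype ι]

theorem summable_prod_apply {κ : Type*} {g : κ → ℝ} (hg₀ : ∀ k, 0 ≤ g k) (hg : Summable g) :
    Summable fun α : ι → κ => ∏ i, g (α i) := by
  classical
  refine summable_of_sum_le (c := ∏ _i : ι, ∑' k, g k)
    (fun α => prod_nonneg fun i _ => hg₀ _) fun s => ?_
  let values : Finset κ := s.biUnion fun α => univ.image α
  have hs : s ⊆ Fintype.piFinset fun _ : ι => values := fun α hα =>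
    Fintype.mem_piFinset.2 fun i => mem_biUnion.2 ⟨α, hα, mem_image_of_mem _ (mem_univ i)⟩
  calc ∑ α ∈ s, ∏ i, g (α i) ≤ ∑ α ∈ Fintype.piFinset fun _ : ι => values, ∏ i, g (α i) :=
        sum_le_sum_of_subset_of_nonneg hs fun α _ _ => prod_nonneg fun i _ => hg₀ _
    _ = ∏ _i : ι, ∑ k ∈ values, g k := (prod_univ_sum (fun _ => values) fun _ k => g k).symm
    _ ≤ ∏ _i : ι, ∑' k, g k := prod_le_prod (fun i _ => sum_nonneg fun k _ => hg₀ k)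
        fun i _ => hg.sum_le_tsum _ fun k _ => hg₀ k

theorem summable_succ_mul_exp_neg_sqrt {c : ℝ} (hc : 0 < c) :
    Summable fun k : ℕ => (k + 1 : ℝ) * Real.exp (-(c * √k)) := by
  have hsq : Summable fun k : ℕ => 2 * 720 / c ^ 6 * (1 / ((k + 1 : ℕ) : ℝ) ^ 2) :=
    ((summable_nat_add_iff 1).2 (Real.summable_one_div_nat_pow.2 one_lt_two)).mul_left _
  refine (summable_nat_add_iff 1).1 (hsq.of_nonneg_of_le (fun k => by positivity) fun k => ?_)
  have hexp : c ^ 6 * ((k + 1 : ℕ) : ℝ) ^ 3 / 720 ≤ Real.exp (c * √(k + 1 : ℕ)) := by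
    have hsqrt : (√((k + 1 : ℕ) : ℝ)) ^ 6 = ((k + 1 : ℕ) : ℝ) ^ 3 := by
      rw [pow_mul _ 2 3, Real.sq_sqrt (Nat.cast_nonneg _)]
    have htaylor := Real.pow_div_factorial_le_exp (c * √((k + 1 : ℕ) : ℝ)) (by positivity) 6
    rwa [mul_pow, hsqrt, show (Nat.factorial 6 : ℝ) = 720 by norm_num [Nat.factorial]] at htaylor
  have hk : (1 : ℝ) ≤ (k + 1 : ℕ) := by simp
  rw [Real.exp_neg]
  calc ((k + 1 : ℕ) + 1 : ℝ) * (Real.exp (c * √(k + 1 : ℕ)))⁻¹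
      ≤ (2 * (k + 1 : ℕ)) * (c ^ 6 * ((k + 1 : ℕ) : ℝ) ^ 3 / 720)⁻¹ := by
        gcongr
        linarith
    _ = 2 * 720 / c ^ 6 * (1 / ((k + 1 : ℕ) : ℝ) ^ 2) := by
        field_simp

theorem exp_neg_sqrt_hermiteEigenvalue_le {t : ℝ} (ht : 0 ≤ t) (lam : ℝ) (α : ι → ℕ) :
    Real.exp (-(t * √(hermiteEigenvalue lam α))) ≤
      ∏ i, Real.exp (-(t * √|lam| / (Fintype.card ι + 1) * √(α i))) := by
  have hcoord (i : ι) : √|lam| * √(α i) ≤ √(hermiteEigenvalue lam α) := by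
    rw [← Real.sqrt_mul (abs_nonneg _), mul_comm]
    refine Real.sqrt_le_sqrt (mul_le_mul_of_nonneg_right ?_ (abs_nonneg _))
    have hle : (α i : ℝ) ≤ ∑ i, (α i : ℝ) :=
      single_le_sum (f := fun i => (α i : ℝ)) (fun i _ => Nat.cast_nonneg _) (mem_univ i)
    linarith [Nat.cast_nonneg (α := ℝ) (α i), Nat.cast_nonneg (α := ℝ) (Fintype.card ι)]
  have hsum : ∑ i, √|lam| * √(α i) ≤ (Fintype.card ι + 1) * √(hermiteEigenvalue lam α) := by
    refine (sum_le_card_nsmul univ _ _ fun i _ => hcoord i).trans ?_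
    rw [card_univ, nsmul_eq_mul]
    gcongr
    exact le_add_of_nonneg_right zero_le_one
  rw [← Real.exp_sum, Real.exp_le_exp, sum_neg_distrib, neg_le_neg_iff]
  calc ∑ i, t * √|lam| / (Fintype.card ι + 1) * √(α i)
      = t * ((∑ i, √|lam| * √(α i)) / (Fintype.card ι + 1)) := by
        rw [sum_div, mul_sum]
        exact sum_congr rfl fun i _ => by ring
    _ ≤ t * √(hermiteEigenvalue lam α) := by
        gcongr
        rwa [div_le_iff₀' (by positivity)]

theorem integrable_scaledHermite {lam : ℝ} (hlam : lam ≠ 0) (α : ι → ℕ) :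
    Integrable (scaledHermite lam α) :=
  (integrable_euclideanSpace_prod fun i =>
    (integrable_hermiteFun (α i)).comp_mul_left' (by positivity : √|lam| ≠ 0)).const_mul _

theorem integral_abs_scaledHermite_le {lam : ℝ} (hlam : lam ≠ 0) (α : ι → ℕ) :
    ∫ x, |scaledHermite lam α x| ≤
      |lam| ^ ((Fintype.card ι : ℝ) / 4) * ∏ i, ((√|lam|)⁻¹ * (3 * (α i + 1))) := by
  simp only [scaledHermite, abs_mul, abs_prod, Real.abs_rpow_of_nonneg (abs_nonneg lam), abs_abs]
  rw [integral_const_mul, integral_euclideanSpace_prod fun i s => |hermiteFun (α i) (√|lam| * s)|]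
  refine mul_le_mul_of_nonneg_left (prod_le_prod
    (fun i _ => integral_nonneg fun _ => abs_nonneg _) fun i _ => ?_) (by positivity)
  rw [Measure.integral_comp_mul_left (fun s => |hermiteFun (α i) s|),
    abs_of_pos (by positivity), smul_eq_mul]
  exact mul_le_mul_of_nonneg_left (integral_abs_hermiteFun_le _) (by positivity)

theorem summable_exp_neg_sqrt_mul_integral_abs_scaledHermite {t lam : ℝ} (ht : 0 < t)
    (hlam : lam ≠ 0) :
    Summable fun α : ι → ℕ => Real.exp (-(t * √(hermiteEigenvalue lam α))) *
      ∫ x, |scaledHermite lam α x| := by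
  let rate := t * √|lam| / (Fintype.card ι + 1)
  have hrate : 0 < rate := by positivity
  have hfactor : Summable fun k : ℕ =>
      (√|lam|)⁻¹ * 3 * ((k + 1) * Real.exp (-(rate * √k))) :=
    (summable_succ_mul_exp_neg_sqrt hrate).mul_left _
  refine ((summable_prod_apply (ι := ι) (fun k => by positivity) hfactor).mul_left
    (|lam| ^ ((Fintype.card ι : ℝ) / 4))).of_nonneg_of_le (fun α => ?_) fun α => ?_
  · exact mul_nonneg (Real.exp_pos _).le (integral_nonneg fun _ => abs_nonneg _)
  · calc Real.exp (-(t * √(hermiteEigenvalue lam α))) * ∫ x, |scaledHermite lam α x|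
        ≤ (∏ i, Real.exp (-(rate * √(α i)))) *
            (|lam| ^ ((Fintype.card ι : ℝ) / 4) * ∏ i, ((√|lam|)⁻¹ * (3 * (α i + 1)))) :=
          mul_le_mul (exp_neg_sqrt_hermiteEigenvalue_le ht.le lam α)
            (integral_abs_scaledHermite_le hlam α) (integral_nonneg fun _ => abs_nonneg _)
            (prod_nonneg fun i _ => (Real.exp_pos _).le)
      _ = _ := by
          rw [mul_left_comm, ← prod_mul_distrib]
          exact congrArg _ (prod_congr rfl fun i _ => by ring)

theorem IsPoissonHermite.integrable {t lam : ℝ} (ht : 0 < t) {hlam : lam ≠ 0} {g f : L2 ι}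
    (h : IsPoissonHermite t lam hlam g f) : Integrable f := by
  have hcoe (c : ℂ) (α : ι → ℕ) :
      c • hermiteL2 lam hlam α =ᵐ[volume] fun x => c * scaledHermite lam α x := by
    filter_upwards [Lp.coeFn_smul c (hermiteL2 lam hlam α), coeFn_hermiteL2 hlam α] with x hsmul hx
    rw [hsmul, Pi.smul_apply, hx, smul_eq_mul]
  have hnorm (c : ℂ) (α : ι → ℕ) :
      ∫ x, ‖(c • hermiteL2 lam hlam α : L2 ι) x‖ = ‖c‖ * ∫ x, |scaledHermite lam α x| := by
    refine (integral_congr_ae ((hcoe c α).fun_comp norm)).trans ?_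
    rw [← integral_const_mul]
    simp only [Function.comp_apply, norm_mul, Complex.norm_real, Real.norm_eq_abs]
  refine integrable_of_hasSum_Lp h (fun α =>
    ((integrable_scaledHermite hlam α).ofReal.const_mul _).congr (hcoe _ α).symm) ?_
  simp only [hnorm]
  refine ((summable_exp_neg_sqrt_mul_integral_abs_scaledHermite ht hlam).mul_left
    ‖g‖).of_nonneg_of_le (fun α => by positivity) fun α => ?_
  have hinner : ‖⟪hermiteL2 lam hlam α, g⟫_ℂ‖ ≤ ‖g‖ := by
    simpa [(orthonormal_hermiteL2 hlam).1] using
      norm_inner_le_norm (𝕜 := ℂ) (hermiteL2 lam hlam α) g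
  rw [norm_mul, Complex.norm_real, Real.norm_of_nonneg (Real.exp_pos _).le, mul_comm (Real.exp _),
    mul_assoc]
  gcongr

end Integrability

/-! ### Special Hermite functions -/

section SpecialHermite

variable {ι : Type}

/-- The identification of `ℝ^{2ι}` with `(ℝ²)^ι` that pairs the coordinates `x i` and `u i`. -/
def pairCoords (ι : Type) : EuclideanSpace ℝ (ι ⊕ ι) ≃ᵐ (ι → ℝ × ℝ) :=
  ((MeasurableEquiv.toLp 2 (ι ⊕ ι → ℝ)).symm.trans
    (MeasurableEquiv.sumPiEquivProdPi fun _ : ι ⊕ ι => ℝ)).trans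
      (MeasurableEquiv.arrowProdEquivProdArrow ℝ ℝ ι).symm

variable [Fintype ι]

theorem measurePreserving_pairCoords : MeasurePreserving (pairCoords ι) :=
  ((EuclideanSpace.volume_preserving_symm_measurableEquiv_toLp (ι ⊕ ι)).trans
    (volume_measurePreserving_sumPiEquivProdPi fun _ : ι ⊕ ι => ℝ)).trans
      (volume_measurePreserving_arrowProdEquivProdArrow ℝ ℝ ι).symm

theorem integral_prod_pairs {𝕜 : Type*} [RCLike 𝕜] (G : ι → ℝ × ℝ → 𝕜) :
    ∫ p : EuclideanSpace ℝ (ι ⊕ ι), ∏ i, G i (p (.inl i), p (.inr i)) = ∏ i, ∫ z, G i z := by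
  rw [← integral_fintype_prod_volume_eq_prod]
  exact measurePreserving_pairCoords.integral_comp' fun z : ι → ℝ × ℝ => ∏ i, G i (z i)

theorem integrable_prod_pairs {𝕜 : Type*} [RCLike 𝕜] {G : ι → ℝ × ℝ → 𝕜}
    (hG : ∀ i, Integrable (G i)) :
    Integrable fun p : EuclideanSpace ℝ (ι ⊕ ι) => ∏ i, G i (p (.inl i), p (.inr i)) :=
  (measurePreserving_pairCoords.integrable_comp_emb
    (MeasurableEquiv.measurableEmbedding _)).2 (Integrable.fintype_prod hG)

/-- The special Hermite function on `ℝ^{2ι}`, that is, the normalised matrix coefficient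
`(2π)^{-d/2} (π(x, u) Φ_k, Φ_j)` as a function of `(x, u)`, where `d = card ι`. -/
def specialHermite (j k : ι → ℕ) (p : EuclideanSpace ℝ (ι ⊕ ι)) : ℂ :=
  ∏ i, specialHermite₁ (j i) (k i) (p (.inl i), p (.inr i))

@[fun_prop]
theorem continuous_specialHermite (j k : ι → ℕ) : Continuous (specialHermite j k) := by
  unfold specialHermite
  fun_prop

theorem memLp_conj_specialHermite (j k : ι → ℕ) :
    MemLp (fun p => conj (specialHermite j k p)) 2 := by
  refine (memLp_two_iff_integrable_sq_norm (by fun_prop)).2 ?_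
  simp only [RCLike.norm_conj, specialHermite, norm_prod, ← prod_pow]
  exact integrable_prod_pairs fun i =>
    (memLp_two_iff_integrable_sq_norm (by fun_prop)).1 (memLp_specialHermite₁ (j i) (k i))

/-- The complex conjugate of the special Hermite function `specialHermite j k` in `L²(ℝ^{2ι})`;
the conjugation makes `⟪specialHermiteL2 j k, F⟫` the integral of `F` against `specialHermite j k`,
with no conjugate. -/
def specialHermiteL2 (j k : ι → ℕ) : L2 (ι ⊕ ι) := (memLp_conj_specialHermite j k).toLp _

theorem coeFn_specialHermiteL2 (j k : ι → ℕ) :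
    specialHermiteL2 j k =ᵐ[volume] fun p => conj (specialHermite j k p) :=
  MemLp.coeFn_toLp _

theorem inner_specialHermiteL2_left (j k : ι → ℕ) (f : L2 (ι ⊕ ι)) :
    ⟪specialHermiteL2 j k, f⟫_ℂ = ∫ p, specialHermite j k p * f p := by
  rw [L2.inner_def]
  refine integral_congr_ae ?_
  filter_upwards [coeFn_specialHermiteL2 j k] with p hp
  rw [hp, RCLike.inner_apply, Complex.conj_conj, mul_comm]

theorem orthonormal_specialHermiteL2 :
    Orthonormal ℂ fun jk : (ι → ℕ) × (ι → ℕ) => specialHermiteL2 jk.1 jk.2 := by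
  classical
  refine orthonormal_iff_ite.2 fun ⟨j, k⟩ ⟨j', k'⟩ => ?_
  have hinner : ⟪specialHermiteL2 j k, specialHermiteL2 j' k'⟫_ℂ =
      ∫ p, specialHermite j k p * conj (specialHermite j' k' p) := by
    rw [inner_specialHermiteL2_left]
    refine integral_congr_ae ?_
    filter_upwards [coeFn_specialHermiteL2 j' k'] with p hp
    rw [hp]
  simp only [hinner, specialHermite, map_prod, ← prod_mul_distrib]
  rw [integral_prod_pairs fun i z => specialHermite₁ (j i) (k i) z *
    conj (specialHermite₁ (j' i) (k' i) z)]
  simp only [integral_specialHermite₁_mul_conj, prod_ite_zero, prod_const_one, mem_univ,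
    forall_true_left, forall_and, funext_iff, Prod.mk.injEq]

theorem scaledHermite_half (α : ι ⊕ ι → ℕ) (p : EuclideanSpace ℝ (ι ⊕ ι)) :
    scaledHermite (1 / 2) α p =
      ∏ i, dilatedHermite (α (.inl i), α (.inr i)) (p (.inl i), p (.inr i)) := by
  have hsqrt (x : ℝ) : √|(1 / 2 : ℝ)| * x = x / √2 := by
    rw [abs_of_pos one_half_pos, Real.sqrt_div zero_le_one, Real.sqrt_one, one_div_mul_eq_div]
  have hconst : |(1 / 2 : ℝ)| ^ ((Fintype.card (ι ⊕ ι) : ℝ) / 4) = (√2)⁻¹ ^ Fintype.card ι := by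
    rw [abs_of_pos one_half_pos, one_div, ← Real.sqrt_inv, Real.sqrt_eq_rpow, ← Real.rpow_natCast,
      ← Real.rpow_mul (by positivity), Fintype.card_sum]
    congr 1
    push_cast
    ring
  simp only [scaledHermite, dilatedHermite, hermiteFun₂, hsqrt, hconst, Fintype.prod_sum_type,
    prod_mul_distrib, prod_const, card_univ]

theorem inner_specialHermiteL2_hermiteL2_eq_zero {j k : ι → ℕ} {α : ι ⊕ ι → ℕ}
    (hα : ∑ i, α i ≠ ∑ i, j i + ∑ i, k i) :
    ⟪specialHermiteL2 j k, hermiteL2 (1 / 2) (by norm_num) α⟫_ℂ = 0 := by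
  obtain ⟨i, hi⟩ : ∃ i, α (.inl i) + α (.inr i) ≠ j i + k i := by
    contrapose! hα
    simp only [Fintype.sum_sum_type, ← sum_add_distrib, hα]
  have hinner : ⟪specialHermiteL2 j k, hermiteL2 (1 / 2) (by norm_num) α⟫_ℂ =
      ∫ p, specialHermite j k p * (scaledHermite (1 / 2) α p : ℂ) := by
    rw [inner_specialHermiteL2_left]
    refine integral_congr_ae ?_
    filter_upwards [coeFn_hermiteL2 (by norm_num : (1 / 2 : ℝ) ≠ 0) α] with p hp
    rw [hp]
  simp only [hinner, specialHermite, scaledHermite_half, Complex.ofReal_prod, ← prod_mul_distrib]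
  rw [integral_prod_pairs fun i z => specialHermite₁ (j i) (k i) z *
    (dilatedHermite (α (.inl i), α (.inr i)) z : ℂ)]
  exact prod_eq_zero (mem_univ i) (integral_specialHermite₁_mul_dilatedHermite_eq_zero hi)

/-- The eigenvalue `|j| + |k| + d` of `H(1/2)` on `ℝ^{2ι}`, `d = card ι`, belonging to the
eigenfunction `specialHermiteL2 j k`. -/
def specialHermiteEigenvalue (j k : ι → ℕ) : ℝ :=
  ∑ i, (j i : ℝ) + ∑ i, (k i : ℝ) + Fintype.card ι

theorem hermiteEigenvalue_half {j k : ι → ℕ} {α : ι ⊕ ι → ℕ}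
    (hα : ∑ i, α i = ∑ i, j i + ∑ i, k i) :
    hermiteEigenvalue (1 / 2) α = specialHermiteEigenvalue j k := by
  have hcast : ∑ i, (α i : ℝ) = ∑ i, (j i : ℝ) + ∑ i, (k i : ℝ) := by exact_mod_cast hα
  rw [hermiteEigenvalue, specialHermiteEigenvalue, hcast, abs_of_pos one_half_pos, Fintype.card_sum]
  push_cast
  ring

theorem IsPoissonHermite.inner_specialHermiteL2 {t : ℝ} {g F : L2 (ι ⊕ ι)}
    (h : IsPoissonHermite t (1 / 2) (by norm_num) g F) (j k : ι → ℕ) :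
    ⟪specialHermiteL2 j k, F⟫_ℂ =
      (Real.exp (-(t * √(specialHermiteEigenvalue j k))) : ℂ) * ⟪specialHermiteL2 j k, g⟫_ℂ := by
  have hF := h.mapL (innerSL ℂ (specialHermiteL2 j k))
  have hg := ((hermiteBasis (by norm_num : (1 / 2 : ℝ) ≠ 0)).hasSum_inner_mul_inner
    (specialHermiteL2 j k) g).mul_left (Real.exp (-(t * √(specialHermiteEigenvalue j k))) : ℂ)
  refine hF.unique (hg.congr_fun fun α => ?_)
  simp only [coe_hermiteBasis, innerSL_apply_apply, inner_smul_right]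
  by_cases hα : ∑ i, α i = ∑ i, j i + ∑ i, k i
  · rw [hermiteEigenvalue_half hα, mul_assoc, mul_comm ⟪hermiteL2 _ _ _, g⟫_ℂ]
  · rw [inner_specialHermiteL2_hermiteL2_eq_zero hα, mul_zero, zero_mul, mul_zero]

end SpecialHermite

/-! ### The Schrödinger representation -/

section Schrodinger

theorem stronglyMeasurable_of_hasSum {X E κ : Type*} [MeasurableSpace X] [NormedAddCommGroup E]
    [Countable κ] {f : κ → X → E} {g : X → E} (hf : ∀ k, StronglyMeasurable (f k))
    (hg : ∀ x, HasSum (fun k => f k x) (g x)) : StronglyMeasurable g :=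
  stronglyMeasurable_of_tendsto (f := fun s x => ∑ k ∈ s, f k x) Filter.atTop
    (fun s => Finset.stronglyMeasurable_fun_sum s fun k _ => hf k) (tendsto_pi_nhds.2 hg)

section HilbertBasis

variable {𝕜 E κ : Type*} [RCLike 𝕜] [NormedAddCommGroup E] [InnerProductSpace 𝕜 E]
  (b : HilbertBasis κ 𝕜 E)

theorem stronglyMeasurable_of_inner_hilbertBasis {X : Type*} [MeasurableSpace X] [Countable κ]
    {f : X → E} (hf : ∀ k, StronglyMeasurable fun x => ⟪b k, f x⟫_𝕜) : StronglyMeasurable f :=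
  stronglyMeasurable_of_hasSum (fun k => (hf k).smul_const (b k)) fun x => by
    simpa only [HilbertBasis.repr_apply_apply] using b.hasSum_repr (f x)

theorem hasSum_inner_mul_inner_map {F : Type*} [NormedAddCommGroup F] [InnerProductSpace 𝕜 F]
    (T : E →L[𝕜] F) (w : F) (φ : E) :
    HasSum (fun k => ⟪b k, φ⟫_𝕜 * ⟪w, T (b k)⟫_𝕜) ⟪w, T φ⟫_𝕜 := by
  simpa [HilbertBasis.repr_apply_apply, inner_smul_right] using
    (b.hasSum_repr φ).mapL ((innerSL 𝕜 w).comp T)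

end HilbertBasis

variable {n : ℕ}

theorem coeFn_schrodinger (x u : EuclideanSpace ℝ (Fin n)) (φ : L2 (Fin n)) :
    schrodinger x u φ =ᵐ[volume] fun ξ =>
      Complex.exp (I * ((⟪x, ξ⟫_ℝ + 1 / 2 * ⟪x, u⟫_ℝ : ℝ) : ℂ)) * φ (ξ + u) :=
  MemLp.coeFn_toLp _

theorem ae_add_right {V : Type*} [MeasurableSpace V] [AddGroup V] [MeasurableAdd V] {μ : Measure V}
    [μ.IsAddRightInvariant] {P : V → Prop} (hP : ∀ᵐ ξ ∂μ, P ξ) (u : V) : ∀ᵐ ξ ∂μ, P (ξ + u) :=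
  (measurePreserving_add_right μ u).quasiMeasurePreserving.ae hP

theorem schrodinger_add (x u : EuclideanSpace ℝ (Fin n)) (φ ψ : L2 (Fin n)) :
    schrodinger x u (φ + ψ) = schrodinger x u φ + schrodinger x u ψ := by
  refine Lp.ext ?_
  filter_upwards [coeFn_schrodinger x u (φ + ψ), coeFn_schrodinger x u φ, coeFn_schrodinger x u ψ,
    Lp.coeFn_add (schrodinger x u φ) (schrodinger x u ψ), ae_add_right (Lp.coeFn_add φ ψ) u]
    with ξ hsum hφ hψ hadd htranslate
  rw [hsum, hadd, Pi.add_apply, hφ, hψ, htranslate, Pi.add_apply, mul_add]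

theorem schrodinger_smul (x u : EuclideanSpace ℝ (Fin n)) (c : ℂ) (φ : L2 (Fin n)) :
    schrodinger x u (c • φ) = c • schrodinger x u φ := by
  refine Lp.ext ?_
  filter_upwards [coeFn_schrodinger x u (c • φ), coeFn_schrodinger x u φ,
    Lp.coeFn_smul c (schrodinger x u φ), ae_add_right (Lp.coeFn_smul c φ) u]
    with ξ hcφ hφ hsmul htranslate
  rw [hcφ, hsmul, Pi.smul_apply, hφ, htranslate, Pi.smul_apply, smul_eq_mul, smul_eq_mul,
    mul_left_comm]

theorem norm_schrodinger (x u : EuclideanSpace ℝ (Fin n)) (φ : L2 (Fin n)) :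
    ‖schrodinger x u φ‖ = ‖φ‖ := by
  rw [Lp.norm_def, Lp.norm_def, ← eLpNorm_comp_measurePreserving (Lp.aestronglyMeasurable φ)
    (measurePreserving_add_right volume u)]
  refine congrArg _ (eLpNorm_congr_norm_ae ?_)
  filter_upwards [coeFn_schrodinger x u φ] with ξ hξ
  rw [hξ, norm_mul, norm_exp_I_mul_ofReal, one_mul, Function.comp_apply]

/-- The operator `π(x, u)` as a linear isometry of `L²(ℝⁿ)`. -/
def schrodingerIsometry (x u : EuclideanSpace ℝ (Fin n)) : L2 (Fin n) →ₗᵢ[ℂ] L2 (Fin n) where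
  toFun := schrodinger x u
  map_add' := schrodinger_add x u
  map_smul' := schrodinger_smul x u
  norm_map' := norm_schrodinger x u

@[simp]
theorem toContinuousLinearMap_schrodingerIsometry_apply (x u : EuclideanSpace ℝ (Fin n))
    (φ : L2 (Fin n)) : (schrodingerIsometry x u).toContinuousLinearMap φ = schrodinger x u φ :=
  rfl

theorem scaledHermite_one {ι : Type} [Fintype ι] (α : ι → ℕ) (x : EuclideanSpace ℝ ι) :
    scaledHermite 1 α x = ∏ i, hermiteFun (α i) (x i) := by
  simp [scaledHermite]

theorem sqrt_two_pi_pow_mul_specialHermite (j k : Fin n → ℕ)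
    (p : EuclideanSpace ℝ (Fin n ⊕ Fin n)) :
    (√(2 * Real.pi) : ℂ) ^ n * specialHermite j k p =
      ∏ i, ∫ s : ℝ, (hermiteFun (j i) s : ℂ) *
        (Complex.exp (I * ((p (.inl i) * s + 1 / 2 * (p (.inl i) * p (.inr i)) : ℝ) : ℂ)) *
          (hermiteFun (k i) (s + p (.inr i)) : ℂ)) := by
  have hsqrt : (√(2 * Real.pi) : ℂ) ≠ 0 := Complex.ofReal_ne_zero.2 (by positivity)
  rw [specialHermite, ← Fin.prod_const, ← prod_mul_distrib]
  refine prod_congr rfl fun i _ => ?_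
  rw [specialHermite₁, Complex.ofReal_inv, mul_inv_cancel_left₀ hsqrt]

theorem inner_hermiteL2_schrodinger (j k : Fin n → ℕ) (p : EuclideanSpace ℝ (Fin n ⊕ Fin n)) :
    ⟪hermiteL2 1 one_ne_zero j,
        schrodinger (fstHalf p) (sndHalf p) (hermiteL2 1 one_ne_zero k)⟫_ℂ =
      (√(2 * Real.pi) : ℂ) ^ n * specialHermite j k p := by
  have hphase (ξ : EuclideanSpace ℝ (Fin n)) :
      ⟪fstHalf p, ξ⟫_ℝ + 1 / 2 * ⟪fstHalf p, sndHalf p⟫_ℝ =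
        ∑ i, (p (.inl i) * ξ i + 1 / 2 * (p (.inl i) * p (.inr i))) := by
    simp [PiLp.inner_apply, fstHalf, sndHalf, sum_add_distrib, mul_sum, mul_comm]
  rw [sqrt_two_pi_pow_mul_specialHermite, ← integral_euclideanSpace_prod, inner_hermiteL2_left]
  refine integral_congr_ae ?_
  filter_upwards [coeFn_schrodinger (fstHalf p) (sndHalf p) (hermiteL2 1 one_ne_zero k),
    ae_add_right (coeFn_hermiteL2 one_ne_zero k) (sndHalf p)] with ξ hπ hk
  rw [hπ, hk, hphase, scaledHermite_one, scaledHermite_one, Complex.ofReal_sum, mul_sum,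
    Complex.exp_sum, Complex.ofReal_prod, Complex.ofReal_prod, ← prod_mul_distrib,
    ← prod_mul_distrib]
  rfl

theorem stronglyMeasurable_schrodinger (φ : L2 (Fin n)) :
    StronglyMeasurable fun p : EuclideanSpace ℝ (Fin n ⊕ Fin n) =>
      schrodinger (fstHalf p) (sndHalf p) φ := by
  refine stronglyMeasurable_of_inner_hilbertBasis (hermiteBasis one_ne_zero) fun j => ?_
  have hcoeff (k : Fin n → ℕ) : StronglyMeasurable fun p : EuclideanSpace ℝ (Fin n ⊕ Fin n) =>
      ⟪hermiteL2 1 one_ne_zero k, φ⟫_ℂ *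
        ((√(2 * Real.pi) : ℂ) ^ n * specialHermite j k p) :=
    Continuous.stronglyMeasurable (by fun_prop)
  refine stronglyMeasurable_of_hasSum hcoeff fun p => ?_
  simpa only [coe_hermiteBasis, toContinuousLinearMap_schrodingerIsometry_apply,
    ← inner_hermiteL2_schrodinger] using
    hasSum_inner_mul_inner_map (hermiteBasis one_ne_zero)
      (schrodingerIsometry (fstHalf p) (sndHalf p)).toContinuousLinearMap
      (hermiteL2 1 one_ne_zero j) φ

end Schrodinger

/-! ### The Weyl transform -/

section Weyl

variable {n : ℕ} {F : L2 (Fin n ⊕ Fin n)}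

theorem integrable_weylIntegrand (hF : Integrable F) (φ : L2 (Fin n)) :
    Integrable (weylIntegrand F φ) := by
  refine (hF.norm.mul_const ‖φ‖).mono'
    (hF.1.smul (stronglyMeasurable_schrodinger φ).aestronglyMeasurable) (.of_forall fun p => ?_)
  rw [weylIntegrand, norm_smul, norm_schrodinger]

/-- The Weyl transform `W(F)` of an integrable function `F` as a bounded operator. -/
def weylOperator (hF : Integrable F) : L2 (Fin n) →L[ℂ] L2 (Fin n) :=
  LinearMap.mkContinuous
    { toFun := weylTransform F
      map_add' := fun φ ψ => by
        rw [weylTransform, weylTransform, weylTransform,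
          ← integral_add (integrable_weylIntegrand hF φ) (integrable_weylIntegrand hF ψ)]
        simp only [weylIntegrand, schrodinger_add, smul_add]
      map_smul' := fun c φ => by
        rw [weylTransform, weylTransform, RingHom.id_apply, ← integral_smul]
        simp only [weylIntegrand, schrodinger_smul, smul_comm c] }
    (∫ p, ‖F p‖) fun φ => by
      refine (norm_integral_le_integral_norm _).trans_eq ?_
      simp only [weylIntegrand, norm_smul, norm_schrodinger, integral_mul_const]

@[simp]
theorem weylOperator_apply (hF : Integrable F) (φ : L2 (Fin n)) :
    weylOperator hF φ = weylTransform F φ :=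
  rfl

theorem inner_hermiteL2_weylTransform_hermiteL2 (hF : Integrable F) (j k : Fin n → ℕ) :
    ⟪hermiteL2 1 one_ne_zero j, weylTransform F (hermiteL2 1 one_ne_zero k)⟫_ℂ =
      (√(2 * Real.pi) : ℂ) ^ n * ⟪specialHermiteL2 j k, F⟫_ℂ := by
  rw [weylTransform, ← integral_inner (integrable_weylIntegrand hF _),
    inner_specialHermiteL2_left, ← integral_const_mul]
  simp only [weylIntegrand, inner_smul_right, inner_hermiteL2_schrodinger]
  exact integral_congr_ae (.of_forall fun p => by ring)

theorem hasSum_inner_hermiteL2_weylTransform (hF : Integrable F) (j : Fin n → ℕ)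
    (φ : L2 (Fin n)) :
    HasSum (fun k => ⟪hermiteL2 1 one_ne_zero k, φ⟫_ℂ *
        ((√(2 * Real.pi) : ℂ) ^ n * ⟪specialHermiteL2 j k, F⟫_ℂ))
      ⟪hermiteL2 1 one_ne_zero j, weylTransform F φ⟫_ℂ := by
  simpa only [coe_hermiteBasis, weylOperator_apply,
    ← inner_hermiteL2_weylTransform_hermiteL2 hF] using
    hasSum_inner_mul_inner_map (hermiteBasis one_ne_zero) (weylOperator hF)
      (hermiteL2 1 one_ne_zero j) φ

end Weyl

/-! ### The image of the Weyl transform -/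

section Image

variable {n : ℕ} {ι : Type} [Fintype ι]

theorem norm_sq_le_tsum_mul_tsum_of_hasSum_mul {κ : Type*} {a b : κ → ℂ} {S : ℂ}
    (hS : HasSum (fun k => a k * b k) S) (ha : Summable fun k => ‖a k‖ ^ 2)
    (hb : Summable fun k => ‖b k‖ ^ 2) :
    ‖S‖ ^ 2 ≤ (∑' k, ‖a k‖ ^ 2) * ∑' k, ‖b k‖ ^ 2 := by
  refine le_of_tendsto (hS.norm.pow 2) (.of_forall fun s => ?_)
  calc ‖∑ k ∈ s, a k * b k‖ ^ 2 ≤ (∑ k ∈ s, ‖a k‖ * ‖b k‖) ^ 2 := by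
        gcongr
        exact (norm_sum_le _ _).trans_eq (by simp only [norm_mul])
    _ ≤ (∑ k ∈ s, ‖a k‖ ^ 2) * ∑ k ∈ s, ‖b k‖ ^ 2 := sum_mul_sq_le_sq_mul_sq _ _ _
    _ ≤ _ := by
        gcongr
        · exact ha.sum_le_tsum _ fun _ _ => sq_nonneg _
        · exact hb.sum_le_tsum _ fun _ _ => sq_nonneg _

theorem sqrt_two_mul_sqrt_specialHermiteEigenvalue (j k : ι → ℕ) :
    √2 * √(specialHermiteEigenvalue j k) =
      √(hermiteEigenvalue 1 j + (2 * ∑ i, (k i : ℝ) + Fintype.card ι)) := by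
  rw [← Real.sqrt_mul zero_le_two, specialHermiteEigenvalue, hermiteEigenvalue, abs_one]
  congr 1
  ring

theorem sqrt_hermiteEigenvalue_le (j k : ι → ℕ) :
    √(hermiteEigenvalue 1 j) ≤ √2 * √(specialHermiteEigenvalue j k) := by
  rw [sqrt_two_mul_sqrt_specialHermiteEigenvalue]
  exact Real.sqrt_le_sqrt (le_add_of_nonneg_right (by positivity))

theorem sqrt_specialHermiteEigenvalue_zero_le (j : ι → ℕ) :
    √2 * √(specialHermiteEigenvalue j 0) ≤ √(hermiteEigenvalue 1 j) + √(Fintype.card ι) := by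
  have hzero : 2 * ∑ i, ((0 : ι → ℕ) i : ℝ) + Fintype.card ι = Fintype.card ι := by simp
  rw [sqrt_two_mul_sqrt_specialHermiteEigenvalue, hzero]
  have hnonneg : 0 ≤ hermiteEigenvalue 1 j := by
    rw [hermiteEigenvalue]
    positivity
  refine Real.sqrt_le_iff.2 ⟨by positivity, ?_⟩
  rw [add_sq, Real.sq_sqrt hnonneg, Real.sq_sqrt (Nat.cast_nonneg _)]
  linarith [mul_nonneg (Real.sqrt_nonneg (hermiteEigenvalue 1 j))
    (Real.sqrt_nonneg (Fintype.card ι : ℝ))]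

theorem IsPoissonHermite.exp_mul_norm_inner_specialHermiteL2_le {t : ℝ} (ht : 0 ≤ t)
    {g F : L2 (ι ⊕ ι)} (h : IsPoissonHermite (√2 * t) (1 / 2) (by norm_num) g F) (j k : ι → ℕ) :
    Real.exp (t * √(hermiteEigenvalue 1 j)) * ‖⟪specialHermiteL2 j k, F⟫_ℂ‖ ≤
      ‖⟪specialHermiteL2 j k, g⟫_ℂ‖ := by
  rw [h.inner_specialHermiteL2, norm_mul, Complex.norm_real,
    Real.norm_of_nonneg (Real.exp_pos _).le, ← mul_assoc, ← Real.exp_add]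
  refine mul_le_of_le_one_left (norm_nonneg _) (Real.exp_le_one_iff.2 ?_)
  linarith [mul_le_mul_of_nonneg_left (sqrt_hermiteEigenvalue_le j k) ht]

theorem summable_norm_sq_inner_specialHermiteL2 (g : L2 (ι ⊕ ι)) :
    Summable fun jk : (ι → ℕ) × (ι → ℕ) => ‖⟪specialHermiteL2 jk.1 jk.2, g⟫_ℂ‖ ^ 2 :=
  orthonormal_specialHermiteL2.inner_products_summable g

theorem IsPoissonHermite.exp_mul_norm_inner_weylTransform_sq_le {t : ℝ} (ht : 0 < t)
    {g F : L2 (Fin n ⊕ Fin n)} (h : IsPoissonHermite (√2 * t) (1 / 2) (by norm_num) g F)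
    (φ : L2 (Fin n)) (j : Fin n → ℕ) :
    (Real.exp (t * √(hermiteEigenvalue 1 j)) *
        ‖⟪hermiteL2 1 one_ne_zero j, weylTransform F φ⟫_ℂ‖) ^ 2 ≤
      (∑' k, ‖⟪hermiteL2 1 one_ne_zero k, φ⟫_ℂ‖ ^ 2) *
        ((√(2 * Real.pi) ^ n) ^ 2 * ∑' k, ‖⟪specialHermiteL2 j k, g⟫_ℂ‖ ^ 2) := by
  have hg : Summable fun k => (√(2 * Real.pi) ^ n) ^ 2 * ‖⟪specialHermiteL2 j k, g⟫_ℂ‖ ^ 2 :=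
    ((summable_norm_sq_inner_specialHermiteL2 g).prod_factor j).mul_left _
  let b (k : Fin n → ℕ) : ℂ := Real.exp (t * √(hermiteEigenvalue 1 j)) *
    ((√(2 * Real.pi) : ℂ) ^ n * ⟪specialHermiteL2 j k, F⟫_ℂ)
  have hb (k : Fin n → ℕ) :
      ‖b k‖ ^ 2 ≤ (√(2 * Real.pi) ^ n) ^ 2 * ‖⟪specialHermiteL2 j k, g⟫_ℂ‖ ^ 2 := by
    simp only [b, norm_mul, norm_pow, Complex.norm_real, Real.norm_of_nonneg (Real.exp_pos _).le,
      Real.norm_of_nonneg (Real.sqrt_nonneg _)]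
    rw [mul_left_comm, mul_pow]
    gcongr
    exact h.exp_mul_norm_inner_specialHermiteL2_le ht.le j k
  have hseries : HasSum (fun k => ⟪hermiteL2 1 one_ne_zero k, φ⟫_ℂ * b k)
      (Real.exp (t * √(hermiteEigenvalue 1 j)) *
        ⟪hermiteL2 1 one_ne_zero j, weylTransform F φ⟫_ℂ) :=
    ((hasSum_inner_hermiteL2_weylTransform (h.integrable (by positivity)) j φ).mul_left
      _).congr_fun fun k => mul_left_comm _ _ _
  have hbsum : Summable fun k => ‖b k‖ ^ 2 := hg.of_nonneg_of_le (fun k => sq_nonneg _) hb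
  have hcauchy := norm_sq_le_tsum_mul_tsum_of_hasSum_mul hseries
    ((orthonormal_hermiteL2 one_ne_zero).inner_products_summable φ) hbsum
  rw [norm_mul, Complex.norm_real, Real.norm_of_nonneg (Real.exp_pos _).le] at hcauchy
  refine hcauchy.trans (mul_le_mul_of_nonneg_left ?_ (tsum_nonneg fun k => sq_nonneg _))
  rw [← tsum_mul_left]
  exact hbsum.tsum_le_tsum hb hg

theorem weylTransform_mem_poissonHermiteSpace {t : ℝ} (ht : 0 < t) {g F : L2 (Fin n ⊕ Fin n)}
    (h : IsPoissonHermite (√2 * t) (1 / 2) (by norm_num) g F) (φ : L2 (Fin n)) :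
    weylTransform F φ ∈ poissonHermiteSpace (Fin n) t 1 one_ne_zero :=
  mem_poissonHermiteSpace_iff_summable.2 <|
    (((summable_norm_sq_inner_specialHermiteL2 g).prod.mul_left _).mul_left _).of_nonneg_of_le
      (fun _ => sq_nonneg _) (h.exp_mul_norm_inner_weylTransform_sq_le ht φ)

theorem exists_mem_poissonHermiteSpace_inner_specialHermiteL2_zero_eq {t : ℝ} (ht : 0 ≤ t)
    {c : (ι → ℕ) → ℂ}
    (hc : Summable fun j => (Real.exp (t * √(hermiteEigenvalue 1 j)) * ‖c j‖) ^ 2) :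
    ∃ F ∈ poissonHermiteSpace (ι ⊕ ι) (√2 * t) (1 / 2) (by norm_num),
      ∀ j, ⟪specialHermiteL2 j 0, F⟫_ℂ = c j := by
  have horth : Orthonormal ℂ fun j : ι → ℕ => specialHermiteL2 j 0 :=
    orthonormal_specialHermiteL2.comp (fun j => (j, 0)) fun _ _ h => congrArg Prod.fst h
  have hexp (j : ι → ℕ) : Real.exp (√2 * t * √(specialHermiteEigenvalue j 0)) ≤
      Real.exp (t * √(Fintype.card ι)) * Real.exp (t * √(hermiteEigenvalue 1 j)) := by
    rw [← Real.exp_add, Real.exp_le_exp]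
    linarith [mul_le_mul_of_nonneg_left (sqrt_specialHermiteEigenvalue_zero_le j) ht]
  obtain ⟨g, hg⟩ := exists_inner_eq_of_summable_norm_sq horth
    (c := fun j => (Real.exp (√2 * t * √(specialHermiteEigenvalue j 0)) : ℂ) * c j) <|
      (hc.mul_left (Real.exp (t * √(Fintype.card ι)) ^ 2)).of_nonneg_of_le
        (fun j => sq_nonneg _) fun j => by
          rw [← mul_pow, ← mul_assoc, norm_mul, Complex.norm_real,
            Real.norm_of_nonneg (Real.exp_pos _).le]
          gcongr
          exact hexp j
  obtain ⟨F, hF⟩ := exists_isPoissonHermite (by positivity : 0 ≤ √2 * t)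
    (by norm_num : (1 / 2 : ℝ) ≠ 0) g
  refine ⟨F, ⟨g, hF⟩, fun j => ?_⟩
  rw [hF.inner_specialHermiteL2, hg, ← mul_assoc, ← Complex.ofReal_mul, ← Real.exp_add,
    neg_add_cancel, Real.exp_zero, Complex.ofReal_one, one_mul]

theorem exists_weylTransform_hermiteL2_zero_eq {t : ℝ} (ht : 0 < t) {ψ : L2 (Fin n)}
    (hψ : ψ ∈ poissonHermiteSpace (Fin n) t 1 one_ne_zero) :
    ∃ F ∈ poissonHermiteSpace (Fin n ⊕ Fin n) (√2 * t) (1 / 2) (by norm_num),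
      weylTransform F (hermiteL2 1 one_ne_zero 0) = ψ := by
  have hconst : (√(2 * Real.pi) : ℂ) ^ n ≠ 0 :=
    pow_ne_zero _ (Complex.ofReal_ne_zero.2 (by positivity))
  let c (j : Fin n → ℕ) : ℂ := ((√(2 * Real.pi) : ℂ) ^ n)⁻¹ * ⟪hermiteL2 1 one_ne_zero j, ψ⟫_ℂ
  have hc : Summable fun j => (Real.exp (t * √(hermiteEigenvalue 1 j)) * ‖c j‖) ^ 2 := by
    simp only [c, norm_mul, mul_left_comm (Real.exp _), mul_pow ‖_‖]
    exact (mem_poissonHermiteSpace_iff_summable.1 hψ).mul_left _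
  obtain ⟨F, hFmem, hF⟩ := exists_mem_poissonHermiteSpace_inner_specialHermiteL2_zero_eq ht.le hc
  obtain ⟨g, hg⟩ := hFmem
  refine ⟨F, ⟨g, hg⟩, sub_eq_zero.1 (eq_zero_of_inner_hermiteL2_eq_zero one_ne_zero fun j => ?_)⟩
  rw [inner_sub_right, inner_hermiteL2_weylTransform_hermiteL2 (hg.integrable (by positivity)), hF,
    mul_inv_cancel_left₀ hconst, sub_self]

end Image

end

/-- For `t > 0`: for `F` in `e^{-√2 t √H(1/2)} L²(ℝ²ⁿ)` and `φ` in `L²(ℝⁿ)` the integral defining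
`W(F) φ` converges absolutely, and the set of all `W(F) φ` is `e^{-t √H} L²(ℝⁿ)`. -/
theorem theorem3p4 (n : ℕ) (t : ℝ) (ht : 0 < t) :
    (∀ F ∈ poissonHermiteSpace (Fin n ⊕ Fin n) (Real.sqrt 2 * t) (1 / 2) (by norm_num),
      ∀ φ : L2 (Fin n), Integrable (weylIntegrand F φ)) ∧
    {ψ : L2 (Fin n) |
      ∃ F ∈ poissonHermiteSpace (Fin n ⊕ Fin n) (Real.sqrt 2 * t) (1 / 2) (by norm_num),
        ∃ φ : L2 (Fin n), weylTransform F φ = ψ} =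
      poissonHermiteSpace (Fin n) t 1 one_ne_zero := by
  refine ⟨fun F ⟨g, hF⟩ φ => integrable_weylIntegrand (hF.integrable (by positivity)) φ,
    Set.Subset.antisymm ?_ ?_⟩
  · rintro _ ⟨F, ⟨g, hF⟩, φ, rfl⟩
    exact weylTransform_mem_poissonHermiteSpace ht hF φ
  · intro ψ hψ
    obtain ⟨F, hF, hFψ⟩ := exists_weylTransform_hermiteL2_zero_eq ht hψ
    exact ⟨F, hF, _, hFψ⟩
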